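/- Let $X$ and $Y$ be complex Banach spaces, let $A\in L(X)$ and $B\in L(Y)$ be bounded linear operators, and let $\rho\colon L(Y,X)\to L(Y,X)$, $\rho(U)=AU-UB$, be the generalized derivation defined by $A$ and $B$. For $K\subseteq\mathbb C$, let $\operatorname{acc}K$ be the set of limit points of $K$ and $\operatorname{iso}K=K\setminus\operatorname{acc}K$; for $K,K'\subseteq\mathbb C$, let $K-K'=\{\mu-\nu:\mu\in K,\ \nu\in K'\}$. For a bounded linear operator $T$ on a complex Banach space, let $\sigma(T)$ be its spectrum. The ascent $\operatorname{asc}(T)$ (respectively the descent $\operatorname{dsc}(T)$) is the smallest integer $n\ge 0$ such that $N(T^n)=N(T^{n+1})$ (respectively $R(T^n)=R(T^{n+1})$), and $\infty$ if there is no such $n$, where $N$ and $R$ denote the null space and the range. Let $$\Pi(T)=\{\lambda\in\sigma(T):\operatorname{asc}(T-\lambda)=\operatorname{dsc}(T-\lambda)<\infty\}$$ be the set of poles of $T$, let $I(T)=\operatorname{iso}\sigma(T)\setminus\Pi(T)$, and let $\sigma_{DR}(T)$ be the set of all $\lambda\in\mathbb C$ such that $T-\lambda$ is not Drazin invertible.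 Here a bounded linear operator $T$ is called Drazin invertible if there are a bounded linear operator $S$ on the same space and an integer $m\ge 0$ with $T^m=T^mST$, $STS=S$ and $TS=ST$. Then the following statements hold. (i) $I(\rho)=\bigl((I(A)-\operatorname{iso}\sigma(B))\cup(\operatorname{iso}\sigma(A)-I(B))\bigr)\setminus\operatorname{acc}\sigma(\rho)$. (ii) $\Pi(\rho)=(\Pi(A)-\Pi(B))\setminus\sigma_{DR}(\rho)$. -/

import Mathlib

open scoped Pointwise

namespace GenDerivation

section Sets

/-- `acc K`: the limit points of `K ⊆ ℂ`. -/
def acc (K : Set ℂ) : Set ℂ := {z | AccPt z (Filter.principal K)}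

/-- `iso K = K \ acc K`: the isolated points of `K ⊆ ℂ`. -/
def iso (K : Set ℂ) : Set ℂ := K \ acc K

end Sets

section Operators

variable {X : Type*} [NormedAddCommGroup X] [NormedSpace ℂ X]

/-- The ascent of `T`: the smallest `n` with `N(T ^ n) = N(T ^ (n + 1))`, and `⊤` if there is
no such `n`. -/
noncomputable def ascent (T : X →L[ℂ] X) : ℕ∞ :=
  ⨅ n : ℕ, ⨅ _ : (T ^ n).ker = (T ^ (n + 1)).ker, (n : ℕ∞)

/-- The descent of `T`: the smallest `n` with `R(T ^ n) = R(T ^ (n + 1))`, and `⊤` if there is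
no such `n`. -/
noncomputable def descent (T : X →L[ℂ] X) : ℕ∞ :=
  ⨅ n : ℕ, ⨅ _ : (T ^ n).range = (T ^ (n + 1)).range, (n : ℕ∞)

/-- `Π(T)`: the poles of `T`, i.e. the points `z` of the spectrum of `T` for which the ascent and
the descent of `T - z` are finite and equal. -/
def poles (T : X →L[ℂ] X) : Set ℂ :=
  {z | z ∈ spectrum ℂ T ∧
    ascent (T - z • 1) = descent (T - z • 1) ∧ descent (T - z • 1) < ⊤}

/-- `I(T) = iso σ(T) \ Π(T)`: the isolated points of the spectrum that are not poles. -/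
def isoNonPoles (T : X →L[ℂ] X) : Set ℂ := iso (spectrum ℂ T) \ poles T

/-- `T` is Drazin invertible: there are `S ∈ L(X)` and `m ∈ ℕ` with
`T ^ m = T ^ m S T`, `S T S = S`, `T S = S T`. -/
def IsDrazinInvertible (T : X →L[ℂ] X) : Prop :=
  ∃ (S : X →L[ℂ] X) (m : ℕ), T ^ m = T ^ m * S * T ∧ S * T * S = S ∧ T * S = S * T

/-- `σ_DR(T)`: the Drazin spectrum. -/
def drazinSpectrum (T : X →L[ℂ] X) : Set ℂ := {z | ¬ IsDrazinInvertible (T - z • 1)}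

end Operators

section Derivation

variable {X Y : Type*} [NormedAddCommGroup X] [NormedSpace ℂ X]
  [NormedAddCommGroup Y] [NormedSpace ℂ Y]

/-- The generalized derivation `ρ = L_A - R_B` on `L(Y, X)`. -/
noncomputable def genDerivation (A : X →L[ℂ] X) (B : Y →L[ℂ] Y) :
    (Y →L[ℂ] X) →L[ℂ] (Y →L[ℂ] X) :=
  ContinuousLinearMap.compL ℂ Y X X A - (ContinuousLinearMap.compL ℂ Y Y X).flip B

/-- `ρ(U) = A U - U B`. -/
theorem genDerivation_apply (A : X →L[ℂ] X) (B : Y →L[ℂ] Y) (U : Y →L[ℂ] X) :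
    genDerivation A B U = A.comp U - U.comp B := rfl

end Derivation

end GenDerivation

/-!
The proof rests on one description of poles: `z` is a pole of `T` exactly when `z ∈ σ(T)` and
`T - z` is Drazin invertible (`mem_poles_iff`). One direction is algebra; for the other, finite
ascent and descent produce a bounded Drazin inverse by the open mapping theorem.

Commuting elements of a Banach algebra are handled by characters. A commuting set lies in a closed,
inverse-closed commutative subalgebra (its double centralizer), in which every non-invertible
element is annihilated by a character, and a character maps each element into its spectrum
(`exists_subalgebra_character`). With this, the inclusion `σ(ρ) ⊆ σ(A) - σ(B)` is immediate, as `ρ`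
is the difference of the commuting operators of left multiplication by `A` and right multiplication
by `B`. The reverse inclusion uses rank one operators `x ⊗ f` and functionals `U ↦ f (U y)`, built
from approximate eigenvectors of one operator and of the dual of the other; a connectedness argument
translates any pair of spectral values to a pair of that kind (`spectrum_genDerivation`).

Consequently, if `z` is isolated in `σ(ρ)` and `z = a - b` with `a ∈ σ(A)`, `b ∈ σ(B)`, then `a` and
`b` are isolated. The key point is `mem_poles_genDerivation_iff`: such a `z` is a pole of `ρ` if and
only if `a` and `b` are poles for every such representation.

* If all of them are poles, there are finitely many pairs `(a, b)`. With `P_a`, `Q_b` the spectral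
  idempotents, the operator `g(U) = ∑ P_a U Q_b` makes `(ρ - z) g` nilpotent and `ρ - z + g`
  invertible, which forces Drazin invertibility (`isDrazin_sub_sub_algebraMap`).
* Conversely, let `P`, `Q` be the Riesz projections of `A` at `a` and of `B` at `b`. The operator
  `U ↦ (ρ - z)(P U Q)` is quasinilpotent, hence nilpotent if `ρ - z` is Drazin invertible.
  Evaluating its powers on rank one operators yields nonzero polynomials annihilating `A - a` on
  the range of `P` and `B - b` on the range of `Q`; quasinilpotent algebraic operators are nilpotent,
  so `a` and `b` are poles.

Both set identities follow by bookkeeping.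
-/

namespace GenDerivation

/-! ### Characters of commutative subalgebras and spectral idempotents -/

section BanachAlgebra

variable {R : Type*} [NormedRing R] [NormedAlgebra ℂ R]

/-- `P` is the spectral idempotent of `T` at `0`: `T` is quasinilpotent on the range of `P` and
invertible on that of `1 - P`. The latter is encoded by the invertibility of `T + P`, and `P` is
asked to commute with the whole commutant of `T`. -/
structure IsSpectralIdempotent (T P : R) : Prop where
  idem : P * P = P
  comm : ∀ x, Commute x T → Commute x P
  quasinilpotent : spectrum ℂ (T * P) ⊆ {0}
  isUnit : IsUnit (T + P)

theorem IsSpectralIdempotent.commute {T P : R} (h : IsSpectralIdempotent T P) : Commute T P :=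
  h.comm T (Commute.refl T)

theorem character_eq_one {T P : R} {C : Subalgebra ℂ R} {φ : C →ₐ[ℂ] ℂ}
    (hφ : ∀ y : C, φ y ∈ spectrum ℂ (y : R)) (hT : T ∈ C) (hP : P ∈ C)
    (hi : P * P = P) (hu : IsUnit (T + P)) (h0 : φ ⟨T, hT⟩ = 0) : φ ⟨P, hP⟩ = 1 := by
  have h1 : φ ⟨P, hP⟩ * φ ⟨P, hP⟩ = φ ⟨P, hP⟩ := by
    rw [← map_mul]; congr 1; exact Subtype.ext hi
  have h2 : φ (⟨T, hT⟩ + ⟨P, hP⟩) ≠ 0 := fun h =>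
    spectrum.zero_notMem ℂ hu (h ▸ hφ (⟨T, hT⟩ + ⟨P, hP⟩))
  rw [map_add, h0, zero_add] at h2
  exact mul_right_cancel₀ h2 (by rw [h1, one_mul])

theorem character_eq_zero {T P : R} {C : Subalgebra ℂ R} {φ : C →ₐ[ℂ] ℂ}
    (hφ : ∀ y : C, φ y ∈ spectrum ℂ (y : R)) (hT : T ∈ C) (hP : P ∈ C)
    (hq : spectrum ℂ (T * P) ⊆ {0}) (h0 : φ ⟨T, hT⟩ ≠ 0) : φ ⟨P, hP⟩ = 0 := by
  have h := hq (hφ (⟨T, hT⟩ * ⟨P, hP⟩))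
  rw [map_mul] at h
  exact (mul_eq_zero.1 h).resolve_left h0

theorem spectrum_subset_of_isNilpotent {x : R} (hx : IsNilpotent x) : spectrum ℂ x ⊆ {0} := by
  intro z hz
  by_contra hz0
  refine hz (spectrum.mem_resolventSet_iff.2 ?_)
  have : IsUnit (algebraMap ℂ R z) := (IsUnit.mk0 z hz0).map _
  rw [sub_eq_add_neg]
  exact hx.neg.isUnit_add_left_of_commute this (Algebra.commutes z (-x)).symm

variable [CompleteSpace R]

/-- The subalgebra `C` is the double centralizer of `s`. It is commutative and closed, and inverses
taken in `R` stay in it, so that Gelfand theory in `C` detects invertibility in `R`. -/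
theorem exists_subalgebra_character (s : Set R) (hs : ∀ x ∈ s, ∀ y ∈ s, Commute x y) :
    ∃ C : Subalgebra ℂ R, s ⊆ C ∧ (∀ x ∈ C, ∀ y ∈ C, Commute x y) ∧
      ∀ x : C, ¬ IsUnit (x : R) →
        ∃ φ : C →ₐ[ℂ] ℂ, φ x = 0 ∧ ∀ y : C, φ y ∈ spectrum ℂ (y : R) := by
  set C : Subalgebra ℂ R := Subalgebra.centralizer ℂ (Set.centralizer s) with hC
  have hsc : s ⊆ Set.centralizer s := fun x hx y hy => (hs y hy x hx)
  have hmem : ∀ x, x ∈ C ↔ ∀ g ∈ Set.centralizer s, g * x = x * g := fun x =>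
    Subalgebra.mem_centralizer_iff ℂ
  have hCs : ∀ x ∈ C, x ∈ Set.centralizer s := fun x hx y hy => (hmem x).1 hx y (hsc hy)
  have hcomm : ∀ x ∈ C, ∀ y ∈ C, Commute x y := fun x hx y hy => (hmem y).1 hy x (hCs x hx)
  have hclosed : IsClosed (C : Set R) := Set.isClosed_centralizer _
  have : CompleteSpace C := hclosed.completeSpace_coe
  let _ : NormedCommRing C :=
    { (inferInstance : NormedRing C) with
      mul_comm := fun x y => Subtype.ext (hcomm x x.2 y y.2) }
  have hunit : ∀ x : C, IsUnit (x : R) → IsUnit x := by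
    rintro ⟨x, hx⟩ ⟨u, rfl : (u : R) = x⟩
    have hu : (↑u⁻¹ : R) ∈ C := (hmem _).2 fun g hg =>
      (show Commute g (↑u : R) from (hmem _).1 hx g hg).units_inv_right
    refine IsUnit.of_mul_eq_one (⟨↑u⁻¹, hu⟩ : C) (Subtype.ext ?_)
    simp
  refine ⟨C, fun x hx => (hmem x).2 fun g hg => (hg x hx).symm, hcomm, fun x hx => ?_⟩
  obtain ⟨φ, hφ⟩ := WeakDual.CharacterSpace.exists_apply_eq_zero (A := C) (a := x)
    fun h => hx (h.map C.val)
  refine ⟨WeakDual.CharacterSpace.toAlgHom φ, hφ, fun y => ?_⟩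
  have h1 : (WeakDual.CharacterSpace.toAlgHom φ) y ∈ spectrum ℂ y :=
    AlgHom.apply_mem_spectrum _ y
  rw [spectrum.mem_iff] at h1 ⊢
  intro h
  exact h1 (hunit _ (by simpa using h))

/-- An element `w` built from three commuting elements is invertible if no character annihilates it.
The hypothesis on `w` says that it lies in every subalgebra containing the three elements. -/
theorem isUnit_of_character {x y z : R} (hxy : Commute x y) (hxz : Commute x z)
    (hyz : Commute y z) {w : R}
    (hw : ∀ C : Subalgebra ℂ R, x ∈ C → y ∈ C → z ∈ C → w ∈ C)
    (h : ∀ C : Subalgebra ℂ R, ∀ (hx : x ∈ C) (hy : y ∈ C) (hz : z ∈ C) (φ : C →ₐ[ℂ] ℂ),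
      (∀ y : C, φ y ∈ spectrum ℂ (y : R)) → φ ⟨w, hw C hx hy hz⟩ ≠ 0) : IsUnit w := by
  obtain ⟨C, hC, -, H⟩ := exists_subalgebra_character ({x, y, z} : Set R) (by
    rintro a (rfl | rfl | rfl) b (rfl | rfl | rfl) <;>
    first | exact Commute.refl _ | assumption | (apply Commute.symm; assumption))
  have hx : x ∈ C := hC (by simp)
  have hy : y ∈ C := hC (by simp)
  have hz : z ∈ C := hC (by simp)
  by_contra hnu
  obtain ⟨φ, h0, hφ⟩ := H ⟨w, hw C hx hy hz⟩ hnu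
  exact h C hx hy hz φ hφ h0

end BanachAlgebra

/-! ### Drazin invertible elements -/

section Drazin

variable {R : Type*} [Ring R]

/-- Drazin invertibility in a ring; on bounded operators this is `IsDrazinInvertible`. -/
def IsDrazin (T : R) : Prop :=
  ∃ (S : R) (m : ℕ), T ^ m = T ^ m * S * T ∧ S * T * S = S ∧ T * S = S * T

/-- If `T ^ m = T ^ (m + 1) s`, then `T ^ m s ^ (m + 1)` is a Drazin inverse. -/
theorem isDrazin_of_pow_eq {T s : R} (hc : Commute T s) {m : ℕ}
    (h : T ^ m = T ^ (m + 1) * s) : IsDrazin T := by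
  have hk : ∀ k, T ^ (m + k) * s ^ k = T ^ m := by
    intro k
    induction k with
    | zero => simp
    | succ k ih =>
      calc T ^ (m + (k + 1)) * s ^ (k + 1) = T ^ k * (T ^ (m + 1) * s) * s ^ k := by
            rw [pow_succ' s, show m + (k + 1) = k + (m + 1) by ring, pow_add]
            simp only [mul_assoc]
        _ = T ^ (m + k) * s ^ k := by rw [← h, ← pow_add, add_comm]
        _ = T ^ m := ih
  have c1 : ∀ i j, s ^ i * T ^ j = T ^ j * s ^ i := fun i j => ((hc.pow_pow j i).symm).eq
  refine ⟨T ^ m * s ^ (m + 1), m, ?_, ?_, ?_⟩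
  · calc T ^ m = T ^ (m + (m + 1)) * s ^ (m + 1) := (hk _).symm
      _ = T ^ m * T ^ m * (T ^ 1 * s ^ (m + 1)) := by
        rw [← add_assoc, pow_add, pow_add]; simp only [mul_assoc]
      _ = _ := by rw [← c1, pow_one]; simp only [mul_assoc]
  · calc T ^ m * s ^ (m + 1) * T * (T ^ m * s ^ (m + 1))
        = T ^ m * (s ^ (m + 1) * T ^ (m + 1)) * s ^ (m + 1) := by
          rw [pow_succ' T]; simp only [mul_assoc]
      _ = T ^ (m + (m + 1)) * s ^ (m + 1) * s ^ (m + 1) := by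
          rw [c1, pow_add T m (m + 1)]; simp only [mul_assoc]
      _ = _ := by rw [hk]
  · exact ((Commute.refl T).pow_right m).mul_right (hc.pow_right _)

/-- No idempotency of `g` is needed here, which is what makes sums of products of spectral
idempotents usable without checking that they are orthogonal. -/
theorem isDrazin_of_isNilpotent_mul {T g : R} (hc : Commute T g) (hn : IsNilpotent (T * g))
    (hu : IsUnit (T + g)) : IsDrazin T := by
  obtain ⟨m, hm⟩ := hn
  obtain ⟨u, hu⟩ := hu
  have hTu : Commute T (↑u⁻¹ : R) := by
    have : Commute T (u : R) := hu ▸ (Commute.refl T).add_right hc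
    exact this.units_inv_right
  have hgu : Commute g (↑u⁻¹ : R) := by
    have : Commute g (u : R) := hu ▸ hc.symm.add_right (Commute.refl g)
    exact this.units_inv_right
  set v : R := ↑u⁻¹
  -- `v * T = 1 - v * g`, and `1 - v * g` divides `1 - (v * g) ^ m`, which is `1` on `T ^ m`
  have h1 : 1 - v * g = T * v := by
    rw [hTu.eq, sub_eq_iff_eq_add, ← mul_add, ← hu]; simp [v]
  set H := ∑ i ∈ Finset.range m, (v * g) ^ i
  have h2 : T * v * H = 1 - (v * g) ^ m := by rw [← h1, mul_neg_geom_sum]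
  have h3 : T ^ m * (v * g) ^ m = 0 := by
    rw [hgu.symm.mul_pow, ← mul_assoc, (hTu.pow_pow m m).eq, mul_assoc, ← hc.mul_pow, hm,
      mul_zero]
  refine isDrazin_of_pow_eq (s := v * H) (m := m) ?_ ?_
  · exact hTu.mul_right (Commute.sum_right _ _ _ fun i _ => (hTu.mul_right hc).pow_right i)
  · rw [pow_succ, mul_assoc, ← mul_assoc T, h2, mul_sub, h3]; simp

end Drazin

section BanachAlgebra

variable {R : Type*} [NormedRing R] [NormedAlgebra ℂ R]

theorem IsSpectralIdempotent.isDrazin {T P : R} (h : IsSpectralIdempotent T P)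
    (hn : IsNilpotent (T * P)) : IsDrazin T :=
  isDrazin_of_isNilpotent_mul h.commute hn h.isUnit

variable [CompleteSpace R]

/-- The spectral idempotent is `1 - S T` for a Drazin inverse `S`. -/
theorem IsDrazin.exists_isSpectralIdempotent {T : R} (h : IsDrazin T) :
    ∃ P, IsSpectralIdempotent T P ∧ IsNilpotent (T * P) := by
  obtain ⟨S, m, h1, h2, h3⟩ := h
  have hTS : Commute T S := h3
  set p := S * T with hp
  have hpT : Commute T p := hTS.mul_right (Commute.refl T)
  have hpp : p * p = p := by
    calc S * T * (S * T) = S * T * S * T := by simp only [mul_assoc]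
      _ = _ := by rw [h2]
  have hpm : ∀ k, p ^ (k + 1) = p := fun k => IsIdempotentElem.pow_succ_eq k hpp
  have hp1 : T ^ m * (1 - p) = 0 := by
    rw [mul_sub, mul_one, hp, ← mul_assoc, ← h1, sub_self]
  have hp2 : (1 - p) * T ^ m = 0 := by
    rw [← hp1]; exact (((Commute.one_right _).sub_right hpT).pow_left m).eq.symm
  have hcomm : ∀ x, Commute x T → Commute x p := by
    intro x hx
    -- both off-diagonal corners of `x` vanish, as `p` is a multiple of `T ^ m`
    have hpS : p = S ^ (m + 1) * T ^ (m + 1) := by rw [← hTS.symm.mul_pow, hpm]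
    have hpS' : p = T ^ (m + 1) * S ^ (m + 1) := by rw [hpS, (hTS.pow_pow _ _).eq]
    have e1 : p * x * (1 - p) = 0 := by
      have hx' : T ^ (m + 1) * x = x * T ^ (m + 1) := (hx.pow_right _).eq.symm
      have : p * x = S ^ (m + 1) * x * T * T ^ m := by
        rw [hpS, mul_assoc, hx', pow_succ' T]; simp only [mul_assoc]
      rw [this, mul_assoc, hp1, mul_zero]
    have e2 : (1 - p) * x * p = 0 := by
      have hx' : x * T ^ (m + 1) = T ^ (m + 1) * x := (hx.pow_right _).eq
      have : x * p = T ^ m * (T * x * S ^ (m + 1)) := by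
        rw [hpS', ← mul_assoc, hx', pow_succ T]; simp only [mul_assoc]
      rw [mul_assoc, this, ← mul_assoc, hp2, zero_mul]
    have e1' : p * x = p * x * p := by rwa [mul_sub, mul_one, sub_eq_zero] at e1
    have e2' : x * p = p * x * p := by rwa [sub_mul, one_mul, sub_mul, sub_eq_zero] at e2
    exact e2'.trans e1'.symm
  have hn : IsNilpotent (T * (1 - p)) := by
    refine ⟨m + 1, ?_⟩
    rw [((Commute.one_right T).sub_right hpT).mul_pow, pow_succ' (1 - p), pow_succ' T,
      mul_assoc, ← mul_assoc _ (1 - p), hp1]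
    simp
  refine ⟨1 - p, ⟨?_, fun x hx => (Commute.one_right x).sub_right (hcomm x hx),
    spectrum_subset_of_isNilpotent hn, ?_⟩, hn⟩
  · exact IsIdempotentElem.one_sub hpp
  · refine isUnit_of_character (x := T) (y := S) (z := T) hTS (Commute.refl T) hTS.symm
      (fun C hT hS _ => C.add_mem hT (C.sub_mem C.one_mem (C.mul_mem hS hT))) ?_
    intro C hT hS _ φ hφ h0
    have e : φ ⟨T, hT⟩ + (1 - φ ⟨S, hS⟩ * φ ⟨T, hT⟩) = 0 := by
      rw [← map_mul, ← map_one φ, ← map_sub, ← map_add]; exact h0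
    have e1 : φ ⟨T, hT⟩ ^ m = φ ⟨T, hT⟩ ^ m * φ ⟨S, hS⟩ * φ ⟨T, hT⟩ := by
      rw [← map_pow, ← map_mul, ← map_mul]; congr 1; exact Subtype.ext h1
    by_cases hT0 : φ ⟨T, hT⟩ = 0
    · simp [hT0] at e
    · have : φ ⟨S, hS⟩ * φ ⟨T, hT⟩ = 1 :=
        mul_left_cancel₀ (pow_ne_zero m hT0) (by rw [mul_one, ← mul_assoc, ← e1])
      rw [this, sub_self, add_zero] at e
      exact hT0 e

/-- A character with `φ T = z ≠ 0` satisfies `φ S * z = 1`, and `‖φ S‖` is bounded by the norm of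
`S`; hence `0` is at most an isolated point of the spectrum of a Drazin invertible element. -/
theorem IsDrazin.isUnit_sub {T : R} (h : IsDrazin T) :
    ∃ ε > 0, ∀ z : ℂ, z ≠ 0 → ‖z‖ < ε → IsUnit (T - algebraMap ℂ R z) := by
  obtain ⟨S, m, h1, h2, h3⟩ := h
  have hTS : Commute T S := h3
  refine ⟨(‖S‖ * ‖(1 : R)‖ + 1)⁻¹, by positivity, fun z hz0 hz => ?_⟩
  refine isUnit_of_character (x := T) (y := S) (z := T) hTS (Commute.refl T) hTS.symm
    (fun C hT hS _ => C.sub_mem hT (C.algebraMap_mem z)) ?_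
  intro C hT hS _ φ hφ h0
  have e : φ ⟨T, hT⟩ = z := by
    have : φ (⟨T, hT⟩ - algebraMap ℂ C z) = 0 := h0
    rwa [map_sub, AlgHom.commutes, sub_eq_zero] at this
  have e1 : φ ⟨T, hT⟩ ^ m = φ ⟨T, hT⟩ ^ m * φ ⟨S, hS⟩ * φ ⟨T, hT⟩ := by
    rw [← map_pow, ← map_mul, ← map_mul]; congr 1; exact Subtype.ext h1
  rw [e] at e1
  have e2 : φ ⟨S, hS⟩ * z = 1 :=
    mul_left_cancel₀ (pow_ne_zero m hz0) (by rw [mul_one, ← mul_assoc, ← e1])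
  have e3 : ‖φ ⟨S, hS⟩‖ ≤ ‖S‖ * ‖(1 : R)‖ := spectrum.norm_le_norm_mul_of_mem (hφ ⟨S, hS⟩)
  have e4 : ‖φ ⟨S, hS⟩‖ * ‖z‖ = 1 := by rw [← norm_mul, e2, norm_one]
  have e5 : (‖S‖ * ‖(1 : R)‖ + 1) * ‖z‖ < 1 := by
    rwa [← lt_inv_mul_iff₀ (by positivity), mul_one]
  nlinarith [norm_nonneg z]

end BanachAlgebra

/-! ### Riesz projections -/

section Riesz

open Metric

variable {R : Type*} [NormedRing R] [NormedAlgebra ℂ R]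

theorem sub_mul_resolvent {T : R} {z : ℂ} (hz : z ∈ resolventSet ℂ T) :
    (algebraMap ℂ R z - T) * resolvent T z = 1 := Ring.mul_inverse_cancel _ hz

theorem commute_resolvent {x T : R} (h : Commute x T) {z : ℂ} (hz : z ∈ resolventSet ℂ T) :
    Commute x (resolvent T z) := by
  obtain ⟨u, hu⟩ := hz
  rw [resolvent, ← hu, Ring.inverse_unit]
  refine Commute.units_inv_right ?_
  rw [hu]
  exact (Algebra.commute_algebraMap_right z x).sub_right h

variable [CompleteSpace R]

theorem mul_circleIntegral (x : R) {f : ℂ → R} {c : ℂ} {r : ℝ} (hf : CircleIntegrable f c r) :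
    x * ∮ z in C(c, r), f z = ∮ z in C(c, r), x * f z := by
  have h := (ContinuousLinearMap.mul ℂ R x).intervalIntegral_comp_comm hf.out
  simp only [ContinuousLinearMap.mul_apply', mul_smul_comm] at h
  exact h.symm

theorem circleIntegral_mul (x : R) {f : ℂ → R} {c : ℂ} {r : ℝ} (hf : CircleIntegrable f c r) :
    (∮ z in C(c, r), f z) * x = ∮ z in C(c, r), f z * x := by
  have h := ((ContinuousLinearMap.mul ℂ R).flip x).intervalIntegral_comp_comm hf.out
  simp only [ContinuousLinearMap.flip_apply, ContinuousLinearMap.mul_apply', smul_mul_assoc] at h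
  exact h.symm

theorem commute_circleIntegral {x : R} {f : ℂ → R} {c : ℂ} {r : ℝ} (hr : 0 ≤ r)
    (hf : CircleIntegrable f c r) (h : ∀ z ∈ sphere c r, Commute x (f z)) :
    Commute x (∮ z in C(c, r), f z) := by
  rw [Commute, SemiconjBy, mul_circleIntegral x hf, circleIntegral_mul x hf]
  exact circleIntegral.integral_congr hr fun z hz => (h z hz).eq

theorem circleIntegral_sub_inv_eq_zero {z : ℂ} {r : ℝ} (hr : 0 < r) (hz : r < ‖z‖) :
    (∮ w in C(0, r), (w - z)⁻¹) = 0 := by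
  have hne : ∀ w ∈ closedBall (0 : ℂ) r, w - z ≠ 0 := by
    intro w hw h
    rw [sub_eq_zero.1 h, mem_closedBall_zero_iff] at hw
    linarith
  refine Complex.circleIntegral_eq_zero_of_differentiable_on_off_countable hr.le
    Set.countable_empty ?_ ?_
  · exact ContinuousOn.inv₀ (by fun_prop) hne
  · intro w hw
    exact DifferentiableAt.inv (by fun_prop) (hne w (ball_subset_closedBall hw.1))

theorem continuousOn_resolvent {T : R} {s : Set ℂ} (hs : s ⊆ resolventSet ℂ T) :
    ContinuousOn (resolvent T) s := fun _ hz =>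
  (spectrum.hasDerivAt_resolvent_const_left (hs hz)).continuousAt.continuousWithinAt

/-- `(z - T) ∮ (w - z)⁻¹ (w - T)⁻¹ dw = ∮ (w - z)⁻¹ dw - ∮ (w - T)⁻¹ dw`. -/
theorem sub_mul_circleIntegral_resolvent {T : R} {r : ℝ} (hr : 0 < r)
    (hs : sphere (0 : ℂ) r ⊆ resolventSet ℂ T) {z : ℂ} (hz : ‖z‖ ≠ r) :
    (algebraMap ℂ R z - T) * ∮ w in C(0, r), (w - z)⁻¹ • resolvent T w =
      algebraMap ℂ R (∮ w in C(0, r), (w - z)⁻¹) - ∮ w in C(0, r), resolvent T w := by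
  have hne : ∀ w ∈ sphere (0 : ℂ) r, w - z ≠ 0 := by
    intro w hw h
    rw [sub_eq_zero.1 h, mem_sphere_zero_iff_norm] at hw
    exact hz hw
  have hc : ContinuousOn (fun w : ℂ => (w - z)⁻¹) (sphere 0 r) :=
    ContinuousOn.inv₀ (by fun_prop) hne
  have hcr := continuousOn_resolvent hs
  have hi : CircleIntegrable (fun w => (w - z)⁻¹ • resolvent T w) 0 r :=
    (hc.smul hcr).circleIntegrable hr.le
  have hi' : CircleIntegrable (fun w : ℂ => (w - z)⁻¹ • (1 : R)) 0 r :=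
    (hc.smul continuousOn_const).circleIntegrable hr.le
  rw [mul_circleIntegral _ hi, Algebra.algebraMap_eq_smul_one (∮ w in C(0, r), (w - z)⁻¹),
    ← circleIntegral.integral_smul_const, ← circleIntegral.integral_sub hi'
      (hcr.circleIntegrable hr.le)]
  refine circleIntegral.integral_congr hr.le fun w hw => ?_
  have h1 : (algebraMap ℂ R z - T) * resolvent T w = 1 - (w - z) • resolvent T w := by
    rw [← sub_mul_resolvent (hs hw), Algebra.smul_def, map_sub, ← sub_mul]
    congr 1; abel
  rw [mul_smul_comm, h1, smul_sub, smul_smul, inv_mul_cancel₀ (hne w hw), one_smul]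

/-- If `0` is isolated in the spectrum of `T`, or outside it, then
`P = (2πi)⁻¹ ∮ (w - T)⁻¹ dw` is a spectral idempotent. With
`G z = (2πi)⁻¹ ∮ (w - z)⁻¹ (w - T)⁻¹ dw` one has `(z - T) G z = 1 - P` inside the circle and
`(z - T) G z = -P` outside. -/
theorem exists_isSpectralIdempotent {T : R} {ε : ℝ} (hε : 0 < ε)
    (hT : ∀ z : ℂ, z ≠ 0 → ‖z‖ < ε → z ∈ resolventSet ℂ T) :
    ∃ P, IsSpectralIdempotent T P := by
  set c : ℂ := (2 * Real.pi * Complex.I)⁻¹ with hc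
  have hc1 : c * (2 * Real.pi * Complex.I) = 1 := by
    rw [hc, inv_mul_cancel₀]; simp [Real.pi_ne_zero]
  set P : ℝ → R := fun r => c • ∮ w in C(0, r), resolvent T w with hP
  set G : ℝ → ℂ → R := fun r z => c • ∮ w in C(0, r), (w - z)⁻¹ • resolvent T w with hG
  have hres : ∀ r, 0 < r → r < ε → sphere (0 : ℂ) r ⊆ resolventSet ℂ T := by
    intro r h0 h1 z hz
    rw [mem_sphere_zero_iff_norm] at hz
    exact hT z (norm_pos_iff.1 (hz ▸ h0)) (hz ▸ h1)
  have hPint : ∀ r, 0 < r → r < ε → CircleIntegrable (resolvent T) 0 r := fun r h0 h1 =>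
    (continuousOn_resolvent (hres r h0 h1)).circleIntegrable h0.le
  have hPeq : ∀ r s, 0 < r → r ≤ s → s < ε → P s = P r := by
    intro r s h0 h1 h2
    have hsub : closedBall (0 : ℂ) s \ ball 0 r ⊆ resolventSet ℂ T := by
      rintro z ⟨hz1, hz2⟩
      rw [mem_closedBall_zero_iff] at hz1
      rw [mem_ball_zero_iff, not_lt] at hz2
      exact hT z (norm_pos_iff.1 (h0.trans_le hz2)) (hz1.trans_lt h2)
    have := Complex.circleIntegral_eq_of_differentiable_on_annulus_off_countable (c := 0) h0 h1
      Set.countable_empty (continuousOn_resolvent hsub) fun z hz =>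
        (spectrum.hasDerivAt_resolvent_const_left (hsub ⟨ball_subset_closedBall hz.1.1,
          fun h => hz.1.2 (ball_subset_closedBall h)⟩)).differentiableAt
    simp only [hP, this]
  have hPcomm : ∀ r, 0 < r → r < ε → ∀ x, Commute x T → Commute x (P r) := by
    intro r h0 h1 x hx
    refine (commute_circleIntegral h0.le (hPint r h0 h1) fun z hz => ?_).smul_right c
    exact commute_resolvent hx (hres r h0 h1 hz)
  have hGin : ∀ r z, 0 < r → r < ε → ‖z‖ < r → (algebraMap ℂ R z - T) * G r z = 1 - P r := by
    intro r z h0 h1 hz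
    simp only [hG, hP]
    rw [mul_smul_comm, sub_mul_circleIntegral_resolvent h0 (hres r h0 h1) hz.ne, smul_sub,
      circleIntegral.integral_sub_inv_of_mem_ball (by simpa using hz), Algebra.smul_def c,
      ← map_mul, hc1, map_one]
  have hGout : ∀ r z, 0 < r → r < ε → r < ‖z‖ → (algebraMap ℂ R z - T) * G r z = - P r := by
    intro r z h0 h1 hz
    simp only [hG, hP]
    rw [mul_smul_comm, sub_mul_circleIntegral_resolvent h0 (hres r h0 h1) hz.ne',
      circleIntegral_sub_inv_eq_zero h0 hz, map_zero, zero_sub, smul_neg]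
  have hGcomm : ∀ r z, 0 < r → r < ε → ‖z‖ ≠ r → ∀ x, Commute x T → Commute x (G r z) := by
    intro r z h0 h1 hz x hx
    have hne : ∀ w ∈ sphere (0 : ℂ) r, w - z ≠ 0 := by
      intro w hw h
      rw [sub_eq_zero.1 h, mem_sphere_zero_iff_norm] at hw
      exact hz hw
    have hcc : ContinuousOn (fun w : ℂ => (w - z)⁻¹) (sphere 0 r) :=
      ContinuousOn.inv₀ (by fun_prop) hne
    refine (commute_circleIntegral h0.le ((hcc.smul
      (continuousOn_resolvent (hres r h0 h1))).circleIntegrable h0.le) fun w hw => ?_).smul_right c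
    exact (commute_resolvent hx (hres r h0 h1 hw)).smul_right _
  obtain ⟨s, hs0, hsε⟩ := exists_between hε
  obtain ⟨r, hr0, hrs⟩ := exists_between hs0
  have hrε := hrs.trans hsε
  lift s to NNReal using hs0.le
  -- `(z - T)⁻¹ (1 - P)` extends analytically to the whole disc, so its integral vanishes
  have hidem : P s * P s = P s := by
    have h0 : P r * (1 - P s) = 0 := by
      have hGan := hasFPowerSeriesOn_cauchy_integral (R := s) (hPint s hs0 hsε) hs0
      have hd : ∀ z ∈ ball (0 : ℂ) s, DifferentiableAt ℂ (G s) z := by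
        intro z hz
        replace hz : z ∈ eball (0 : ℂ) s := by rwa [Metric.eball_coe]
        exact (hGan.differentiableOn z hz).differentiableAt (Metric.isOpen_eball.mem_nhds hz)
      have hsub : closedBall (0 : ℂ) r ⊆ ball 0 s := closedBall_subset_ball hrs
      have h1 : (∮ z in C(0, r), G s z) = 0 :=
        Complex.circleIntegral_eq_zero_of_differentiable_on_off_countable hr0.le
          Set.countable_empty (fun z hz => (hd z (hsub hz)).continuousAt.continuousWithinAt)
          fun z hz => hd z (hsub (ball_subset_closedBall hz.1))
      simp only [hP]
      rw [smul_mul_assoc, circleIntegral_mul _ (hPint r hr0 hrε)]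
      refine (congrArg (c • ·) ?_).trans (smul_zero c)
      rw [← h1]
      refine circleIntegral.integral_congr hr0.le fun z hz => ?_
      have hzr : ‖z‖ = r := mem_sphere_zero_iff_norm.1 hz
      rw [← hGin s z hs0 hsε (hzr ▸ hrs), ← mul_assoc]
      rw [resolvent, Ring.inverse_mul_cancel _ (hres r hr0 hrε hz), one_mul]
    rw [← hPeq r s hr0 hrs.le hsε, mul_sub, mul_one, sub_eq_zero] at h0
    exact h0.symm
  have hPT : Commute T (P s) := hPcomm s hs0 hsε T (Commute.refl T)
  have hq : spectrum ℂ (T * P s) ⊆ {0} := by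
    intro z hz
    by_contra hz0
    have hz0 : z ≠ 0 := hz0
    -- a circle so small that `z` lies outside it computes the same `P`
    obtain ⟨t, ht0, ht⟩ := exists_between (lt_min (norm_pos_iff.2 hz0) hs0)
    have htz := ht.trans_le (min_le_left _ _)
    have hts := ht.trans_le (min_le_right _ _)
    have hF := hGout t z ht0 (hts.trans hsε) htz
    rw [← hPeq t s ht0 hts.le hsε] at hF
    have hTF : Commute T (G t z) := hGcomm t z ht0 (hts.trans hsε) htz.ne' T (Commute.refl T)
    have hPF : Commute (P s) (G t z) :=
      hGcomm t z ht0 (hts.trans hsε) htz.ne' _ hPT.symm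
    refine hz (spectrum.mem_resolventSet_iff.2 (isUnit_of_character hPT hTF hPF
      (fun C hT hP _ => C.sub_mem (C.algebraMap_mem z) (C.mul_mem hT hP)) ?_))
    intro C hTC hPC hFC φ _ h0
    have e0 : z - φ ⟨T, hTC⟩ * φ ⟨P s, hPC⟩ = 0 := by
      have : φ (algebraMap ℂ C z - ⟨T, hTC⟩ * ⟨P s, hPC⟩) = 0 := h0
      rwa [map_sub, AlgHom.commutes, map_mul] at this
    have e1 : (z - φ ⟨T, hTC⟩) * φ ⟨G t z, hFC⟩ = - φ ⟨P s, hPC⟩ := by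
      have : φ ((algebraMap ℂ C z - ⟨T, hTC⟩) * ⟨G t z, hFC⟩) = φ (-⟨P s, hPC⟩) :=
        congrArg φ (Subtype.ext hF)
      rwa [map_mul, map_sub, AlgHom.commutes, map_neg] at this
    have e2 : φ ⟨P s, hPC⟩ * φ ⟨P s, hPC⟩ = φ ⟨P s, hPC⟩ := by
      rw [← map_mul]; exact congrArg φ (Subtype.ext hidem)
    rcases mul_eq_zero.1 (show φ ⟨P s, hPC⟩ * (φ ⟨P s, hPC⟩ - 1) = 0 by
      rw [mul_sub, e2, mul_one, sub_self]) with h | h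
    · rw [h, mul_zero, sub_zero] at e0
      exact hz0 e0
    · rw [sub_eq_zero.1 h, mul_one] at e0
      rw [e0, zero_mul, sub_eq_zero.1 h] at e1
      norm_num at e1
  refine ⟨P s, hidem, hPcomm s hs0 hsε, hq, ?_⟩
  have hG0 := hGin s 0 hs0 hsε (by simpa using hs0)
  rw [map_zero, zero_sub] at hG0
  have hn : ‖(0 : ℂ)‖ ≠ s := by simpa using hs0.ne
  refine isUnit_of_character hPT (hGcomm s 0 hs0 hsε hn T (Commute.refl T))
    (hGcomm s 0 hs0 hsε hn _ hPT.symm) (fun C hT hP _ => C.add_mem hT hP) ?_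
  intro C hTC hPC hFC φ hφ h0
  have e0 : φ ⟨T, hTC⟩ + φ ⟨P s, hPC⟩ = 0 := by rw [← map_add]; exact h0
  have e1 : - φ ⟨T, hTC⟩ * φ ⟨G s 0, hFC⟩ = 1 - φ ⟨P s, hPC⟩ := by
    rw [← map_neg, ← map_mul, ← map_one φ, ← map_sub]; exact congrArg φ (Subtype.ext hG0)
  by_cases hT0 : φ ⟨T, hTC⟩ = 0
  · rw [hT0, zero_add] at e0
    rw [hT0, e0] at e1
    norm_num at e1
  · rw [character_eq_zero hφ hTC hPC hq hT0, add_zero] at e0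
    exact hT0 e0

end Riesz

/-! ### Left and right multiplication -/

section LeftRight

variable {X Y : Type*} [NormedAddCommGroup X] [NormedSpace ℂ X]
  [NormedAddCommGroup Y] [NormedSpace ℂ Y]

/-- Left multiplication `U ↦ A U` on `L(Y, X)`. -/
noncomputable def leftMul (Y : Type*) [NormedAddCommGroup Y] [NormedSpace ℂ Y] :
    (X →L[ℂ] X) →ₐ[ℂ] ((Y →L[ℂ] X) →L[ℂ] (Y →L[ℂ] X)) where
  toFun A := ContinuousLinearMap.compL ℂ Y X X A
  map_one' := rfl
  map_mul' _ _ := rfl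
  map_zero' := map_zero _
  map_add' := map_add _
  commutes' _ := rfl

/-- Right multiplication `U ↦ U B` on `L(Y, X)`, which reverses products. -/
noncomputable def rightMul (X : Type*) [NormedAddCommGroup X] [NormedSpace ℂ X] :
    (Y →L[ℂ] Y)ᵐᵒᵖ →ₐ[ℂ] ((Y →L[ℂ] X) →L[ℂ] (Y →L[ℂ] X)) where
  toFun B := (ContinuousLinearMap.compL ℂ Y Y X).flip B.unop
  map_one' := rfl
  map_mul' _ _ := rfl
  map_zero' := map_zero _
  map_add' a b := map_add _ a.unop b.unop
  commutes' c := by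
    ext U y
    simp [Algebra.algebraMap_eq_smul_one]

theorem leftMul_apply (A : X →L[ℂ] X) (U : Y →L[ℂ] X) : leftMul Y A U = A.comp U := rfl

theorem rightMul_apply (B : Y →L[ℂ] Y) (U : Y →L[ℂ] X) :
    rightMul X (MulOpposite.op B) U = U.comp B := rfl

theorem genDerivation_eq (A : X →L[ℂ] X) (B : Y →L[ℂ] Y) :
    genDerivation A B = leftMul Y A - rightMul X (MulOpposite.op B) := rfl

theorem commute_leftMul_rightMul (A : X →L[ℂ] X) (B : (Y →L[ℂ] Y)ᵐᵒᵖ) :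
    Commute (leftMul Y A) (rightMul X B) := rfl

theorem spectrum_leftMul_subset (A : X →L[ℂ] X) :
    spectrum ℂ (leftMul Y A) ⊆ spectrum ℂ A := AlgHom.spectrum_apply_subset _ _

theorem spectrum_op {R : Type*} [Ring R] [Algebra ℂ R] (B : R) :
    spectrum ℂ (MulOpposite.op B) = spectrum ℂ B := by
  ext z
  rw [spectrum.mem_iff, spectrum.mem_iff, MulOpposite.algebraMap_apply, ← MulOpposite.op_sub,
    isUnit_op]

theorem spectrum_rightMul_subset (B : Y →L[ℂ] Y) :
    spectrum ℂ (rightMul X (MulOpposite.op B)) ⊆ spectrum ℂ B :=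
  (AlgHom.spectrum_apply_subset _ _).trans (spectrum_op B).subset

theorem genDerivation_sub (A : X →L[ℂ] X) (B : Y →L[ℂ] Y) {a b z : ℂ} (h : a - b = z) :
    genDerivation A B - z • 1 = genDerivation (A - a • 1) (B - b • 1) := by
  ext U y
  simp only [genDerivation_apply, sub_apply, smul_apply,
    one_apply_eq_self, ContinuousLinearMap.comp_apply, map_sub, map_smul, ← h,
    sub_smul]
  abel

theorem mem_spectrum_iff {T : X →L[ℂ] X} {z : ℂ} :
    z ∈ spectrum ℂ T ↔ ¬ IsUnit (T - z • 1) := by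
  rw [spectrum.mem_iff, Algebra.algebraMap_eq_smul_one, ← IsUnit.neg_iff, neg_sub]

theorem spectrum_genDerivation_subset [CompleteSpace X] (A : X →L[ℂ] X) (B : Y →L[ℂ] Y) :
    spectrum ℂ (genDerivation A B) ⊆ spectrum ℂ A - spectrum ℂ B := by
  intro z hz
  set l := leftMul Y A with hl
  set r := rightMul X (MulOpposite.op B) with hr
  have hlr : Commute l r := commute_leftMul_rightMul _ _
  by_contra hcon
  rw [mem_spectrum_iff, ← Algebra.algebraMap_eq_smul_one] at hz
  refine hz (isUnit_of_character hlr (Commute.refl l) hlr.symm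
    (fun C h1 h2 _ => C.sub_mem (C.sub_mem h1 h2) (C.algebraMap_mem z)) ?_)
  intro C h1 h2 _ φ hφ h0
  have e : φ (⟨l, h1⟩ - ⟨r, h2⟩ - algebraMap ℂ C z) = 0 := h0
  rw [map_sub, map_sub, AlgHom.commutes, sub_eq_zero] at e
  exact hcon ⟨_, spectrum_leftMul_subset A (hφ ⟨l, h1⟩), _,
    spectrum_rightMul_subset B (hφ ⟨r, h2⟩), e⟩

end LeftRight

/-! ### The spectrum of the generalized derivation -/

section ApproximateSpectra

variable {X Y : Type*} [NormedAddCommGroup X] [NormedSpace ℂ X]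
  [NormedAddCommGroup Y] [NormedSpace ℂ Y]

/-- The approximate point spectrum: `A - a` is not bounded below. -/
def approxSpectrum (A : X →L[ℂ] X) : Set ℂ :=
  {a | ∀ c > 0, ∃ x, ‖(A - a • 1) x‖ < c * ‖x‖}

/-- The approximate point spectrum of the Banach space dual of `A`. -/
def dualApproxSpectrum (A : X →L[ℂ] X) : Set ℂ :=
  {a | ∀ c > 0, ∃ f : X →L[ℂ] ℂ, ‖f.comp (A - a • 1)‖ < c * ‖f‖}

theorem isClosed_approxSpectrum (A : X →L[ℂ] X) : IsClosed (approxSpectrum A) := by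
  rw [isClosed_iff_clusterPt]
  intro a ha c hc
  rw [← mem_closure_iff_clusterPt, Metric.mem_closure_iff] at ha
  obtain ⟨b, hb, hab⟩ := ha (c / 2) (by positivity)
  obtain ⟨x, hx⟩ := hb (c / 2) (by positivity)
  refine ⟨x, ?_⟩
  have e : (A - a • 1) x = (A - b • 1) x + (b - a) • x := by
    simp [sub_smul]
  have h1 : ‖(b - a) • x‖ ≤ c / 2 * ‖x‖ := by
    rw [norm_smul, ← dist_eq_norm, dist_comm]; gcongr
  rw [e]
  linarith [norm_add_le ((A - b • 1) x) ((b - a) • x)]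

theorem isClosed_dualApproxSpectrum (A : X →L[ℂ] X) : IsClosed (dualApproxSpectrum A) := by
  rw [isClosed_iff_clusterPt]
  intro a ha c hc
  rw [← mem_closure_iff_clusterPt, Metric.mem_closure_iff] at ha
  obtain ⟨b, hb, hab⟩ := ha (c / 2) (by positivity)
  obtain ⟨f, hf⟩ := hb (c / 2) (by positivity)
  refine ⟨f, ?_⟩
  have e : f.comp (A - a • 1) = f.comp (A - b • 1) + (b - a) • f := by
    ext x
    simp only [ContinuousLinearMap.comp_apply, sub_apply,
      smul_apply, one_apply_eq_self,
      add_apply, map_sub, map_smul, sub_smul]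
    abel
  have h1 : ‖(b - a) • f‖ ≤ c / 2 * ‖f‖ := by
    rw [norm_smul, ← dist_eq_norm, dist_comm]; gcongr
  rw [e]
  linarith [norm_add_le (f.comp (A - b • 1)) ((b - a) • f)]

theorem isUnit_of_norm_inv_le [CompleteSpace X] {T V : X →L[ℂ] X} (u : (X →L[ℂ] X)ˣ)
    (hu : (u : X →L[ℂ] X) = V) {c : ℝ} (hc : 0 < c)
    (h : ∀ x, c * ‖(↑u⁻¹ : X →L[ℂ] X) x‖ ≤ ‖x‖) (hTV : ‖T - V‖ < c) : IsUnit T := by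
  have hn : ‖(↑u⁻¹ : X →L[ℂ] X)‖ ≤ c⁻¹ :=
    ContinuousLinearMap.opNorm_le_bound _ (by positivity) fun x => by
      rw [inv_mul_eq_div, le_div_iff₀ hc, mul_comm]; exact h x
  have h1 : IsUnit ((1 : X →L[ℂ] X) - ↑u⁻¹ * (V - T)) := by
    refine (Units.oneSub _ ?_).isUnit
    calc ‖(↑u⁻¹ : X →L[ℂ] X) * (V - T)‖ ≤ c⁻¹ * ‖V - T‖ :=
          (norm_mul_le _ _).trans (by gcongr)
      _ < c⁻¹ * c := by rw [norm_sub_rev]; gcongr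
      _ = 1 := inv_mul_cancel₀ hc.ne'
  have h2 : T = u * (1 - ↑u⁻¹ * (V - T)) := by
    rw [mul_sub, mul_one, ← mul_assoc, Units.mul_inv, one_mul, hu]; abel
  rw [h2]
  exact u.isUnit.mul h1

theorem norm_sub_smul_one_sub_le (A : X →L[ℂ] X) (a w : ℂ) :
    ‖(A - a • 1) - (A - w • 1)‖ ≤ dist a w := by
  have : (A - a • 1) - (A - w • 1) = (w - a) • (1 : X →L[ℂ] X) := by rw [sub_smul]; abel
  rw [this, norm_smul, dist_comm, dist_eq_norm]
  exact mul_le_of_le_one_right (norm_nonneg _) ContinuousLinearMap.norm_id_le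

/-- A spectral value with `A - a` bounded below is interior to the spectrum: inverses of
`A - w` for `w` near `a` would be uniformly bounded. -/
theorem isOpen_spectrum_diff_approxSpectrum [CompleteSpace X] (A : X →L[ℂ] X) :
    IsOpen (spectrum ℂ A \ approxSpectrum A) := by
  rw [Metric.isOpen_iff]
  rintro a ⟨ha, ha'⟩
  obtain ⟨ε, hε, hb⟩ := Metric.isOpen_iff.1 (isClosed_approxSpectrum A).isOpen_compl a ha'
  simp only [approxSpectrum, Set.mem_ofPred_eq, not_forall, not_exists, not_lt] at ha'
  obtain ⟨c, hc, hca⟩ := ha'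
  refine ⟨min ε (c / 2), by positivity, fun w hw => ⟨?_, hb (Metric.ball_subset_ball
    (min_le_left _ _) hw)⟩⟩
  have hwc : dist a w < c / 2 := by
    rw [dist_comm]; exact (Metric.mem_ball.1 hw).trans_le (min_le_right _ _)
  rw [mem_spectrum_iff] at ha ⊢
  rintro ⟨u, hu⟩
  have hd := (norm_sub_smul_one_sub_le A a w).trans_lt hwc
  refine ha (isUnit_of_norm_inv_le u hu (half_pos hc) (fun x => ?_) hd)
  set y := (↑u⁻¹ : X →L[ℂ] X) x
  have hy : (A - w • 1) y = x := by
    rw [← hu]; exact DFunLike.congr_fun u.mul_inv x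
  have h1 := hca y
  have h2 : (A - a • 1) y = ((A - a • 1) - (A - w • 1)) y + x := by
    rw [sub_apply (A - a • 1), hy, sub_add_cancel]
  have h3 := ((A - a • 1) - (A - w • 1)).le_opNorm y
  have h4 := norm_add_le (((A - a • 1) - (A - w • 1)) y) x
  rw [← h2] at h4
  have h5 := mul_le_mul_of_nonneg_right hd.le (norm_nonneg y)
  linarith

/-- The dual counterpart of `isOpen_spectrum_diff_approxSpectrum`. -/
theorem isOpen_spectrum_diff_dualApproxSpectrum [CompleteSpace X] (A : X →L[ℂ] X) :
    IsOpen (spectrum ℂ A \ dualApproxSpectrum A) := by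
  rw [Metric.isOpen_iff]
  rintro a ⟨ha, ha'⟩
  obtain ⟨ε, hε, hb⟩ := Metric.isOpen_iff.1 (isClosed_dualApproxSpectrum A).isOpen_compl a ha'
  simp only [dualApproxSpectrum, Set.mem_ofPred_eq, not_forall, not_exists, not_lt] at ha'
  obtain ⟨c, hc, hca⟩ := ha'
  refine ⟨min ε (c / 2), by positivity, fun w hw => ⟨?_, hb (Metric.ball_subset_ball
    (min_le_left _ _) hw)⟩⟩
  have hwc : dist a w < c / 2 := by
    rw [dist_comm]; exact (Metric.mem_ball.1 hw).trans_le (min_le_right _ _)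
  rw [mem_spectrum_iff] at ha ⊢
  rintro ⟨u, hu⟩
  have hd := (norm_sub_smul_one_sub_le A a w).trans_lt hwc
  refine ha (isUnit_of_norm_inv_le u hu (half_pos hc) (fun x => ?_) hd)
  set y := (↑u⁻¹ : X →L[ℂ] X) x with hy
  -- estimate `‖y‖` by a norming functional, moved through the inverse
  obtain ⟨f, hf1, hfy⟩ := exists_dual_vector'' ℂ y
  set g : X →L[ℂ] ℂ := f.comp (↑u⁻¹ : X →L[ℂ] X) with hg
  have hgf : g.comp (A - w • 1) = f := by
    ext v
    rw [← hu]
    exact congrArg f (DFunLike.congr_fun u.inv_mul v)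
  have h1 := hca g
  have h2 : g.comp (A - a • 1) = g.comp ((A - a • 1) - (A - w • 1)) + f := by
    rw [g.comp_sub (A - a • 1) (A - w • 1), hgf, sub_add_cancel]
  have h3 := g.opNorm_comp_le ((A - a • 1) - (A - w • 1))
  have h4 := norm_add_le (g.comp ((A - a • 1) - (A - w • 1))) f
  rw [← h2] at h4
  have h5 := mul_le_mul_of_nonneg_left hd.le (norm_nonneg g)
  have h6 : ‖y‖ ≤ ‖g‖ * ‖x‖ := by
    have : ‖f y‖ ≤ ‖g‖ * ‖x‖ := g.le_opNorm x
    rwa [hfy, RCLike.norm_ofReal, abs_norm] at this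
  have h7 : c / 2 * ‖g‖ ≤ 1 := by linarith
  calc c / 2 * ‖y‖ ≤ c / 2 * (‖g‖ * ‖x‖) := by gcongr
    _ = c / 2 * ‖g‖ * ‖x‖ := by ring
    _ ≤ 1 * ‖x‖ := by gcongr
    _ = ‖x‖ := one_mul _

/-- If `A - a` is bounded below, its range is closed; if also its dual is bounded below, the range
is dense by the Hahn-Banach theorem. -/
theorem spectrum_subset_approx_union [CompleteSpace X] (A : X →L[ℂ] X) :
    spectrum ℂ A ⊆ approxSpectrum A ∪ dualApproxSpectrum A := by
  intro a ha
  by_contra h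
  rw [Set.mem_union, not_or] at h
  obtain ⟨h1, h2⟩ := h
  simp only [approxSpectrum, dualApproxSpectrum, Set.mem_ofPred_eq, not_forall, not_exists,
    not_lt] at h1 h2
  obtain ⟨c, hc, h1⟩ := h1
  obtain ⟨d, hd, h2⟩ := h2
  refine mem_spectrum_iff.1 ha ?_
  set T := A - a • (1 : X →L[ℂ] X)
  have hanti : AntilipschitzWith ⟨c⁻¹, by positivity⟩ T :=
    AddMonoidHomClass.antilipschitz_of_bound T fun x => by
      change ‖x‖ ≤ c⁻¹ * ‖T x‖
      rw [inv_mul_eq_div, le_div_iff₀ hc, mul_comm]; exact h1 x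
  have hclosed : IsClosed (T.range : Set X) := by
    rw [LinearMap.coe_range]; exact hanti.isClosed_range T.uniformContinuous
  have hker : T.ker = ⊥ := LinearMap.ker_eq_bot.2 hanti.injective
  have hrange : T.range = ⊤ := by
    by_contra hne
    obtain ⟨x, hx⟩ : ∃ x, x ∉ T.range := by
      by_contra hcon; push Not at hcon; exact hne (Submodule.eq_top_iff'.2 hcon)
    obtain ⟨f, hf, hfx⟩ : ∃ f : X →L[ℂ] ℂ, f x ≠ 0 ∧ ∀ y ∈ T.range, f y = 0 := by
      have hx' : T.range.mkQ x ≠ 0 := by rwa [Submodule.mkQ_apply, Ne, Submodule.Quotient.mk_eq_zero]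
      obtain ⟨g, hg⟩ := SeparatingDual.exists_ne_zero (R := ℂ) hx'
      refine ⟨g.comp T.range.mkQL, hg, fun y hy => ?_⟩
      have : T.range.mkQL y = 0 := (Submodule.Quotient.mk_eq_zero _).2 hy
      rw [ContinuousLinearMap.comp_apply, this, map_zero]
    have h0 : f.comp T = 0 := by
      ext v; exact hfx _ ⟨v, rfl⟩
    have := h2 f
    rw [h0, norm_zero] at this
    have hf0 : ‖f‖ = 0 := le_antisymm (by nlinarith [norm_nonneg f]) (norm_nonneg f)
    rw [norm_eq_zero] at hf0
    simp [hf0] at hf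
  exact ContinuousLinearMap.isUnit_iff_bijective.2
    ⟨hanti.injective, LinearMap.range_eq_top.1 hrange⟩

/-- Let two compact sets `S`, `S'` be covered by parts `Sp`, `Sd` and `Sp'`, `Sd'`. Points of `S`
and `S'` that lie in neither `Sd` nor `Sd'` can be translated simultaneously to points in opposite
parts. -/
theorem exists_translate_mem {S Sp Sd S' Sp' Sd' : Set ℂ} (hS : IsCompact S) (hS' : IsCompact S')
    (hp : IsClosed Sp) (hp' : IsClosed Sp') (hd : IsOpen (S \ Sd)) (hd' : IsOpen (S' \ Sd'))
    (hu : S ⊆ Sp ∪ Sd) (hu' : S' ⊆ Sp' ∪ Sd') {a b : ℂ} (ha : a ∈ S) (hb : b ∈ S')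
    (ha' : a ∉ Sd) (hb' : b ∉ Sd') :
    ∃ z, (a + z ∈ Sp ∧ b + z ∈ Sd') ∨ (a + z ∈ Sd ∧ b + z ∈ Sp') := by
  -- `W` is open, nonempty and bounded, hence not closed; a point of `closure W \ W` will do
  set W : Set ℂ := {z | a + z ∈ S \ Sd ∧ b + z ∈ S' \ Sd'} with hW
  have hWo : IsOpen W := (hd.preimage (continuous_const_add a)).inter
    (hd'.preimage (continuous_const_add b))
  set K : Set ℂ := {z | (a + z ∈ S ∧ a + z ∈ Sp) ∧ (b + z ∈ S' ∧ b + z ∈ Sp')} with hK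
  have hKc : IsClosed K := ((hS.isClosed.inter hp).preimage (continuous_const_add a)).inter
    ((hS'.isClosed.inter hp').preimage (continuous_const_add b))
  have hWK : W ⊆ K := fun z hz => ⟨⟨hz.1.1, (hu hz.1.1).resolve_right hz.1.2⟩,
    ⟨hz.2.1, (hu' hz.2.1).resolve_right hz.2.2⟩⟩
  have h0 : (0 : ℂ) ∈ W := by simp [hW, ha, hb, ha', hb']
  have hne : ¬ IsClosed W := by
    intro hc
    rcases isClopen_iff.1 ⟨hc, hWo⟩ with h | h
    · rw [h] at h0; exact h0
    · have : S = Set.univ := Set.eq_univ_of_forall fun z => by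
        have hz : z - a ∈ W := h ▸ Set.mem_univ _
        have := hz.1.1
        rwa [add_sub_cancel] at this
      exact noncompact_univ ℂ (this ▸ hS)
  obtain ⟨z, hz, hzW⟩ : ∃ z ∈ closure W, z ∉ W := by
    by_contra hcon
    push Not at hcon
    exact hne (isClosed_of_closure_subset hcon)
  have hzK : z ∈ K := closure_minimal hWK hKc hz
  refine ⟨z, ?_⟩
  by_cases h1 : b + z ∈ Sd'
  · exact Or.inl ⟨hzK.1.2, h1⟩
  · by_cases h2 : a + z ∈ Sd
    · exact Or.inr ⟨h2, hzK.2.2⟩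
    · exact absurd ⟨⟨hzK.1.1, h2⟩, ⟨hzK.2.1, h1⟩⟩ hzW

/-- The rank one operators `x ⊗ f` built from approximate eigenvectors `x` of `A` and `f` of the
dual of `B` show that `ρ - (a - b)` is not bounded below. -/
theorem sub_mem_spectrum_of_approx_dual {A : X →L[ℂ] X} {B : Y →L[ℂ] Y} {a b : ℂ}
    (ha : a ∈ approxSpectrum A) (hb : b ∈ dualApproxSpectrum B) :
    a - b ∈ spectrum ℂ (genDerivation A B) := by
  rw [mem_spectrum_iff, genDerivation_sub A B rfl]
  rintro ⟨u, hu⟩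
  set c : ℝ := (3 * (‖(↑u⁻¹ : (Y →L[ℂ] X) →L[ℂ] (Y →L[ℂ] X))‖ + 1))⁻¹ with hc
  have hcpos : 0 < c := by positivity
  obtain ⟨x, hx⟩ := ha c hcpos
  obtain ⟨f, hf⟩ := hb c hcpos
  have hx0 : 0 < ‖x‖ := by
    by_contra h; nlinarith [norm_nonneg x, norm_nonneg ((A - a • 1) x)]
  have hf0 : 0 < ‖f‖ := by
    by_contra h; nlinarith [norm_nonneg f, norm_nonneg (f.comp (B - b • 1))]
  set U : Y →L[ℂ] X := f.smulRight x with hU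
  have e1 : genDerivation (A - a • 1) (B - b • 1) U =
      f.smulRight ((A - a • 1) x) - (f.comp (B - b • 1)).smulRight x := by
    rw [genDerivation_apply, hU]
    ext y
    simp [smul_sub, sub_smul, mul_smul, smul_comm (f y) a x]
  have hUn : ‖U‖ = ‖f‖ * ‖x‖ := ContinuousLinearMap.norm_smulRight_apply f x
  have e2 : ‖genDerivation (A - a • 1) (B - b • 1) U‖ ≤ 2 * c * ‖U‖ := by
    rw [e1]
    refine (norm_sub_le _ _).trans ?_
    rw [ContinuousLinearMap.norm_smulRight_apply, ContinuousLinearMap.norm_smulRight_apply, hUn]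
    nlinarith
  have e3 : U = (↑u⁻¹ : (Y →L[ℂ] X) →L[ℂ] (Y →L[ℂ] X))
      (genDerivation (A - a • 1) (B - b • 1) U) := by
    rw [← hu]; exact (DFunLike.congr_fun u.inv_mul U).symm
  have e4 := (↑u⁻¹ : (Y →L[ℂ] X) →L[ℂ] (Y →L[ℂ] X)).le_opNorm
      (genDerivation (A - a • 1) (B - b • 1) U)
  rw [← e3] at e4
  set k := ‖(↑u⁻¹ : (Y →L[ℂ] X) →L[ℂ] (Y →L[ℂ] X))‖
  have hk : 0 ≤ k := norm_nonneg _
  have e5 : ‖U‖ ≤ (k + 1) * (2 * c * ‖U‖) :=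
    e4.trans ((mul_le_mul_of_nonneg_left e2 hk).trans (by gcongr; linarith))
  have e6 : (k + 1) * c = 1 / 3 := by rw [hc]; field_simp
  have e7 : 0 < ‖U‖ := by rw [hUn]; positivity
  have e8 : (k + 1) * (2 * c * ‖U‖) = 2 * ((k + 1) * c) * ‖U‖ := by ring
  rw [e8, e6] at e5
  linarith

/-- The functionals `U ↦ f (U y)` built from approximate eigenvectors `f` of the dual of `A` and `y`
of `B` show that the inverse of `ρ - (a - b)` cannot be bounded. -/
theorem sub_mem_spectrum_of_dual_approx {A : X →L[ℂ] X} {B : Y →L[ℂ] Y} {a b : ℂ}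
    (ha : a ∈ dualApproxSpectrum A) (hb : b ∈ approxSpectrum B) :
    a - b ∈ spectrum ℂ (genDerivation A B) := by
  rw [mem_spectrum_iff, genDerivation_sub A B rfl]
  rintro ⟨u, hu⟩
  set k := ‖(↑u⁻¹ : (Y →L[ℂ] X) →L[ℂ] (Y →L[ℂ] X))‖ with hk
  have hk0 : 0 ≤ k := norm_nonneg _
  set c : ℝ := (4 * (k + 1))⁻¹ with hc
  have hcpos : 0 < c := by positivity
  obtain ⟨f, hf⟩ := ha c hcpos
  obtain ⟨y, hy⟩ := hb c hcpos
  have hy0 : 0 < ‖y‖ := by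
    by_contra h; nlinarith [norm_nonneg y, norm_nonneg ((B - b • 1) y)]
  have hf0 : 0 < ‖f‖ := by
    by_contra h; nlinarith [norm_nonneg f, norm_nonneg (f.comp (A - a • 1))]
  -- the functional `V ↦ f (V y)` has norm `‖f‖ ‖y‖` but is small on the range
  obtain ⟨x, hx⟩ : ∃ x, ‖f‖ / 2 * ‖x‖ < ‖f x‖ := by
    by_contra hcon
    push Not at hcon
    have := f.opNorm_le_bound (by positivity) hcon
    linarith
  obtain ⟨g, hg1, hgy⟩ := exists_dual_vector'' ℂ y
  set V : Y →L[ℂ] X := g.smulRight x with hV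
  set U := (↑u⁻¹ : (Y →L[ℂ] X) →L[ℂ] (Y →L[ℂ] X)) V with hU
  have e1 : genDerivation (A - a • 1) (B - b • 1) U = V := by
    rw [← hu]; exact DFunLike.congr_fun u.mul_inv V
  have e2 : f (V y) = (f.comp (A - a • 1)) (U y) - f (U ((B - b • 1) y)) := by
    rw [← e1, genDerivation_apply]
    simp only [sub_apply, ContinuousLinearMap.comp_apply, map_sub]
  have e3 : ‖f (V y)‖ = ‖y‖ * ‖f x‖ := by
    rw [hV, ContinuousLinearMap.smulRight_apply, map_smul, norm_smul, hgy, RCLike.norm_ofReal,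
      abs_norm]
  have hVn : ‖V‖ ≤ ‖x‖ := by
    rw [hV, ContinuousLinearMap.norm_smulRight_apply]
    exact mul_le_of_le_one_left (norm_nonneg x) hg1
  have hUn : ‖U‖ ≤ (k + 1) * ‖x‖ :=
    ((↑u⁻¹ : (Y →L[ℂ] X) →L[ℂ] (Y →L[ℂ] X)).le_opNorm V).trans
      (mul_le_mul (by linarith) hVn (norm_nonneg _) (by linarith))
  have e4 : ‖(f.comp (A - a • 1)) (U y)‖ ≤ c * ‖f‖ * (‖U‖ * ‖y‖) :=
    (ContinuousLinearMap.le_opNorm _ _).trans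
      (mul_le_mul hf.le (U.le_opNorm y) (norm_nonneg _) (by positivity))
  have e5 : ‖f (U ((B - b • 1) y))‖ ≤ ‖f‖ * (‖U‖ * (c * ‖y‖)) :=
    (f.le_opNorm _).trans (mul_le_mul_of_nonneg_left ((U.le_opNorm _).trans
      (mul_le_mul_of_nonneg_left hy.le (norm_nonneg _))) (norm_nonneg _))
  have e6 : ‖f (V y)‖ ≤ 2 * c * ‖f‖ * ‖y‖ * ‖U‖ := by
    rw [e2]
    refine (norm_sub_le _ _).trans ((add_le_add e4 e5).trans_eq (by ring))
  have e7 : 2 * c * ‖f‖ * ‖y‖ * ‖U‖ ≤ 2 * c * ‖f‖ * ‖y‖ * ((k + 1) * ‖x‖) := by gcongr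
  have e8 : 2 * c * ‖f‖ * ‖y‖ * ((k + 1) * ‖x‖) = ‖y‖ * (‖f‖ / 2 * ‖x‖) := by
    rw [hc]; field_simp; norm_num
  have e9 := mul_lt_mul_of_pos_left hx hy0
  linarith

/-- The Lumer-Rosenblum theorem: `σ(ρ) = σ(A) - σ(B)`. -/
theorem spectrum_genDerivation [CompleteSpace X] [CompleteSpace Y] (A : X →L[ℂ] X)
    (B : Y →L[ℂ] Y) :
    spectrum ℂ (genDerivation A B) = spectrum ℂ A - spectrum ℂ B := by
  refine (spectrum_genDerivation_subset A B).antisymm ?_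
  rintro _ ⟨a, ha, b, hb, rfl⟩
  have key : ∃ z, (a + z ∈ approxSpectrum A ∧ b + z ∈ dualApproxSpectrum B) ∨
      (a + z ∈ dualApproxSpectrum A ∧ b + z ∈ approxSpectrum B) := by
    have hSA := spectrum.isCompact (𝕜 := ℂ) A
    have hSB := spectrum.isCompact (𝕜 := ℂ) B
    by_cases h1 : a ∈ dualApproxSpectrum A
    · by_cases h2 : b ∈ approxSpectrum B
      · exact ⟨0, Or.inr (by simpa using ⟨h1, h2⟩)⟩
      · by_cases h3 : a ∈ approxSpectrum A
        · have h4 := (spectrum_subset_approx_union B hb).resolve_left h2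
          exact ⟨0, Or.inl (by simpa using ⟨h3, h4⟩)⟩
        · obtain ⟨z, hz⟩ := exists_translate_mem hSA hSB (isClosed_dualApproxSpectrum A)
            (isClosed_dualApproxSpectrum B) (isOpen_spectrum_diff_approxSpectrum A)
            (isOpen_spectrum_diff_approxSpectrum B)
            ((spectrum_subset_approx_union A).trans (Set.union_comm _ _).subset)
            ((spectrum_subset_approx_union B).trans (Set.union_comm _ _).subset) ha hb h3 h2
          exact ⟨z, hz.symm⟩
    · by_cases h2 : b ∈ dualApproxSpectrum B
      · have h4 := (spectrum_subset_approx_union A ha).resolve_right h1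
        exact ⟨0, Or.inl (by simpa using ⟨h4, h2⟩)⟩
      · exact exists_translate_mem hSA hSB (isClosed_approxSpectrum A)
          (isClosed_approxSpectrum B) (isOpen_spectrum_diff_dualApproxSpectrum A)
          (isOpen_spectrum_diff_dualApproxSpectrum B) (spectrum_subset_approx_union A)
          (spectrum_subset_approx_union B) ha hb h1 h2
  obtain ⟨z, ⟨h1, h2⟩ | ⟨h1, h2⟩⟩ := key
  · simpa using sub_mem_spectrum_of_approx_dual h1 h2
  · simpa using sub_mem_spectrum_of_dual_approx h1 h2

end ApproximateSpectra

/-! ### Poles and Drazin invertibility -/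

section Poles

variable {X : Type*} [NormedAddCommGroup X] [NormedSpace ℂ X]

theorem ker_pow_eq_iff {T : X →L[ℂ] X} {n : ℕ} :
    (T ^ n).ker = (T ^ (n + 1)).ker ↔ ∀ x, (T ^ (n + 1)) x = 0 → (T ^ n) x = 0 := by
  constructor
  · intro h x hx
    have : x ∈ (T ^ n).ker := h ▸ hx
    exact this
  · intro h
    refine le_antisymm (fun x hx => ?_) h
    change (T ^ (n + 1)) x = 0
    rw [pow_succ', mul_apply_eq_comp, show (T ^ n) x = 0 from hx, map_zero]

theorem range_pow_eq_iff {T : X →L[ℂ] X} {n : ℕ} :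
    (T ^ n).range = (T ^ (n + 1)).range ↔ ∀ x, ∃ u, (T ^ (n + 1)) u = (T ^ n) x := by
  constructor
  · intro h x
    have : (T ^ n) x ∈ (T ^ (n + 1)).range := h ▸ ⟨x, rfl⟩
    exact this
  · intro h
    refine le_antisymm ?_ ?_
    · rintro _ ⟨x, rfl⟩
      exact h x
    · rintro _ ⟨x, rfl⟩
      exact ⟨T x, by rw [pow_succ]; rfl⟩

theorem pow_add_apply (T : X →L[ℂ] X) (m n : ℕ) (x : X) :
    (T ^ (m + n)) x = (T ^ m) ((T ^ n) x) := by
  rw [pow_add]; rfl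

theorem ker_stable {T : X →L[ℂ] X} {n : ℕ} (h : ∀ x, (T ^ (n + 1)) x = 0 → (T ^ n) x = 0)
    (k : ℕ) (x : X) (hx : (T ^ (n + k)) x = 0) : (T ^ n) x = 0 := by
  induction k generalizing x with
  | zero => exact hx
  | succ k ih =>
    refine ih x ?_
    rw [pow_add_apply]
    apply h
    rwa [← pow_add_apply, add_assoc, add_comm 1 k]

theorem range_stable {T : X →L[ℂ] X} {n : ℕ} (h : ∀ x, ∃ u, (T ^ (n + 1)) u = (T ^ n) x)
    (k : ℕ) (x : X) : ∃ u, (T ^ (n + k)) u = (T ^ n) x := by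
  induction k generalizing x with
  | zero => exact ⟨x, rfl⟩
  | succ k ih =>
    obtain ⟨u, hu⟩ := ih x
    obtain ⟨v, hv⟩ := h u
    refine ⟨v, ?_⟩
    rw [← hu, show n + (k + 1) = k + (n + 1) by ring, pow_add_apply, hv, ← pow_add_apply,
      add_comm]

/-- Finite ascent and descent: with `V = T ^ n`, the surjection `(k, u) ↦ k + T V u` from
`N(V) × X` is open, so that `k + T V u ↦ V u` is a bounded Drazin inverse. -/
theorem isDrazin_of_ker_of_range [CompleteSpace X] {T : X →L[ℂ] X} {n : ℕ}
    (h1 : ∀ x, (T ^ (n + 1)) x = 0 → (T ^ n) x = 0)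
    (h2 : ∀ x, ∃ u, (T ^ (n + 1)) u = (T ^ n) x) : IsDrazin T := by
  set N := (T ^ n).ker with hN
  have : CompleteSpace N := (T ^ n).isClosed_ker.completeSpace_coe
  let J : (N × X) →L[ℂ] X := N.subtypeL.coprod (T ^ (n + 1))
  have hJ : ∀ p : N × X, J p = (p.1 : X) + (T ^ (n + 1)) p.2 := fun p => rfl
  have hNk : ∀ k : N, (T ^ n) (k : X) = 0 := fun k => k.2
  have hsurj : Function.Surjective J := by
    intro x
    obtain ⟨u, hu⟩ := range_stable h2 (n + 1) x
    refine ⟨(⟨x - (T ^ (n + 1)) u, ?_⟩, u), ?_⟩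
    · change (T ^ n) _ = 0
      rw [map_sub, ← pow_add_apply, hu, sub_self]
    · rw [hJ]; exact sub_add_cancel _ _
  have hker : ∀ p, J p = 0 → (T ^ n) p.2 = 0 := by
    intro p hp
    refine ker_stable h1 (n + 1) _ ?_
    have := congrArg (T ^ n) hp
    rwa [hJ, map_add, hNk, zero_add, map_zero, ← pow_add_apply] at this
  obtain ⟨g, hg⟩ := (J : (N × X) →ₗ[ℂ] X).exists_rightInverse_of_surjective
    (LinearMap.range_eq_top.2 hsurj)
  have hgJ : ∀ x, J (g x) = x := fun x => LinearMap.congr_fun hg x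
  let S₀ : X →ₗ[ℂ] X := (T ^ n : X →L[ℂ] X).toLinearMap ∘ₗ LinearMap.snd ℂ N X ∘ₗ g
  have hS₀ : ∀ p, S₀ (J p) = (T ^ n) p.2 := by
    intro p
    have := hker (g (J p) - p) (by rw [map_sub, hgJ, sub_self])
    rw [Prod.snd_sub, map_sub, sub_eq_zero] at this
    exact this
  have hcont : Continuous S₀ := by
    rw [(J.isQuotientMap hsurj).continuous_iff]
    have : (S₀ ∘ J) = fun p : N × X => (T ^ n) p.2 := funext hS₀
    rw [this]
    fun_prop
  let S : X →L[ℂ] X := ⟨S₀, hcont⟩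
  have hS : ∀ (k : N) (u : X), S ((k : X) + (T ^ (n + 1)) u) = (T ^ n) u := fun k u => hS₀ (k, u)
  have hS' : ∀ u : X, S ((T ^ (n + 1)) u) = (T ^ n) u := by
    intro u
    simpa using hS 0 u
  have hTn : ∀ u, T ((T ^ n) u) = (T ^ (n + 1)) u := fun u => by rw [pow_succ']; rfl
  have hTn' : ∀ u, (T ^ n) (T u) = (T ^ (n + 1)) u := fun u => by rw [pow_succ]; rfl
  have hTk : ∀ k : N, T k ∈ N := by
    intro k
    change (T ^ n) (T k) = 0
    rw [hTn', ← hTn, hNk, map_zero]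
  have hST : ∀ (k : N) (u : X), S (T ((k : X) + (T ^ (n + 1)) u)) = (T ^ (n + 1)) u := by
    intro k u
    have e : T ((k : X) + (T ^ (n + 1)) u) =
        ((⟨T k, hTk k⟩ : N) : X) + (T ^ (n + 1)) (T u) := by
      rw [map_add]
      congr 1
      change (T * T ^ (n + 1)) u = (T ^ (n + 1) * T) u
      rw [← pow_succ, ← pow_succ']
    rw [e, hS, hTn']
  refine ⟨S, n, ?_, ?_, ?_⟩
  · ext x
    obtain ⟨⟨k, u⟩, rfl⟩ := hsurj x
    change (T ^ n) (J (k, u)) = (T ^ n) (S (T (J (k, u))))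
    rw [hJ, hST, map_add, hNk, zero_add]
  · ext x
    obtain ⟨⟨k, u⟩, rfl⟩ := hsurj x
    change S (T (S (J (k, u)))) = S (J (k, u))
    rw [hJ, hS, hTn, hS']
  · ext x
    obtain ⟨⟨k, u⟩, rfl⟩ := hsurj x
    change T (S (J (k, u))) = S (T (J (k, u)))
    rw [hJ, hS, hTn, hST]

/-- For a Drazin invertible operator the null spaces and the ranges of the powers stabilize at the
same exponents, so that ascent and descent agree. -/
theorem IsDrazin.ker_iff_range {T : X →L[ℂ] X} (h : IsDrazin T) (n : ℕ) :
    (T ^ n).ker = (T ^ (n + 1)).ker ↔ (T ^ n).range = (T ^ (n + 1)).range := by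
  obtain ⟨S, m, e1, -, e3⟩ := h
  have hTS : Commute T S := e3
  have hm : ∀ x, (T ^ m) (x - S (T x)) = 0 := by
    intro x
    rw [map_sub, sub_eq_zero]
    exact DFunLike.congr_fun e1 x
  have hc : ∀ k x, (T ^ k) (S (T x)) = S (T ((T ^ k) x)) := fun k x =>
    (DFunLike.congr_fun ((hTS.symm.mul_left (Commute.refl T)).pow_right k).eq x).symm
  rw [ker_pow_eq_iff, range_pow_eq_iff]
  constructor
  · intro h1 x
    refine ⟨S x, ?_⟩
    have h0 : (T ^ n) (x - S (T x)) = 0 := by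
      refine ker_stable h1 m _ ?_
      rw [pow_add_apply, hm, map_zero]
    rw [map_sub, sub_eq_zero] at h0
    rw [h0, pow_succ]
    exact congrArg (T ^ n) (DFunLike.congr_fun e3 x)
  · intro h2 x hx
    obtain ⟨u, hu⟩ := range_stable h2 m x
    have h0 : (T ^ n) x = S (T ((T ^ n) x)) := by
      rw [← hu, ← hc, ← sub_eq_zero, ← map_sub, pow_add_apply, hm, map_zero]
    rw [h0, ← mul_apply_eq_comp T, ← pow_succ', hx, map_zero]

theorem ascent_lt_top {T : X →L[ℂ] X} :
    ascent T < ⊤ ↔ ∃ n, (T ^ n).ker = (T ^ (n + 1)).ker := by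
  simp [ascent, iInf_lt_iff]

theorem descent_lt_top {T : X →L[ℂ] X} :
    descent T < ⊤ ↔ ∃ n, (T ^ n).range = (T ^ (n + 1)).range := by
  simp [descent, iInf_lt_iff]

/-- The poles of `T` are the spectral values `z` at which `T - z` is Drazin invertible. -/
theorem mem_poles_iff [CompleteSpace X] {T : X →L[ℂ] X} {z : ℂ} :
    z ∈ poles T ↔ z ∈ spectrum ℂ T ∧ IsDrazin (T - z • 1) := by
  refine and_congr_right fun _ => ⟨?_, fun h => ⟨?_, ?_⟩⟩
  · rintro ⟨h1, h2⟩
    obtain ⟨p, hp⟩ := ascent_lt_top.1 (h1 ▸ h2)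
    obtain ⟨q, hq⟩ := descent_lt_top.1 h2
    rw [ker_pow_eq_iff] at hp
    rw [range_pow_eq_iff] at hq
    refine isDrazin_of_ker_of_range (n := p + q) (fun x hx => ?_) (fun x => ?_)
    · have := ker_stable hp (q + 1) x (by rwa [← add_assoc])
      rw [add_comm, pow_add_apply, this, map_zero]
    · obtain ⟨u, hu⟩ := hq x
      refine ⟨u, ?_⟩
      rw [add_assoc, pow_add_apply, hu, ← pow_add_apply]
  · simp only [ascent, descent, h.ker_iff_range]
  · rw [descent_lt_top]
    obtain ⟨S, m, e1, -, e3⟩ := h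
    refine ⟨m, range_pow_eq_iff.2 fun x => ⟨S x, ?_⟩⟩
    have e : (T - z • 1) ^ m = (T - z • 1) ^ (m + 1) * S := by
      rw [pow_succ, mul_assoc, e3, ← mul_assoc, ← e1]
    exact (DFunLike.congr_fun e x).symm

end Poles

/-! ### Drazin invertibility of the derivation from that of its coefficients -/

section BanachAlgebra

variable {R : Type*} [NormedRing R] [NormedAlgebra ℂ R] [CompleteSpace R]

/-- The elements `p a` and `q a` play the part of spectral idempotents of `l` at `a` and of `r` at
`a - z`, and `F` contains every spectral value `a` of `l` for which `a - z` is one of `r`.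
The element `g = ∑ p a * q a` makes `T g` nilpotent and `T + g` invertible, where `T = l - r - z`. -/
theorem isDrazin_sub_sub_algebraMap {l r : R} {p q : ℂ → R} {F : Finset ℂ} {z : ℂ}
    (hs : ∀ x ∈ {l} ∪ {r} ∪ p '' F ∪ q '' F, ∀ y ∈ {l} ∪ {r} ∪ p '' F ∪ q '' F, Commute x y)
    (hF : ∀ a ∈ spectrum ℂ l, a - z ∈ spectrum ℂ r → a ∈ F)
    (hpi : ∀ a ∈ F, p a * p a = p a) (hqi : ∀ a ∈ F, q a * q a = q a)
    (hpn : ∀ a ∈ F, IsNilpotent ((l - algebraMap ℂ R a) * p a))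
    (hqn : ∀ a ∈ F, IsNilpotent ((r - algebraMap ℂ R (a - z)) * q a))
    (hpu : ∀ a ∈ F, IsUnit (l - algebraMap ℂ R a + p a))
    (hqu : ∀ a ∈ F, IsUnit (r - algebraMap ℂ R (a - z) + q a)) :
    IsDrazin (l - r - algebraMap ℂ R z) := by
  obtain ⟨C, hC, hcomm, hchar⟩ := exists_subalgebra_character _ hs
  have hlC : l ∈ C := hC (Or.inl (Or.inl (Or.inl rfl)))
  have hrC : r ∈ C := hC (Or.inl (Or.inl (Or.inr rfl)))
  have hpC : ∀ a ∈ F, p a ∈ C := fun a ha => hC (Or.inl (Or.inr ⟨a, ha, rfl⟩))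
  have hqC : ∀ a ∈ F, q a ∈ C := fun a ha => hC (Or.inr ⟨a, ha, rfl⟩)
  have hlaC : ∀ a : ℂ, l - algebraMap ℂ R a ∈ C := fun a => C.sub_mem hlC (C.algebraMap_mem a)
  have hraC : ∀ a : ℂ, r - algebraMap ℂ R a ∈ C := fun a => C.sub_mem hrC (C.algebraMap_mem a)
  set T := l - r - algebraMap ℂ R z with hT
  have hTC : T ∈ C := C.sub_mem (C.sub_mem hlC hrC) (C.algebraMap_mem z)
  set g := ∑ a ∈ F, p a * q a with hg
  have hgC : g ∈ C := C.sum_mem fun a ha => C.mul_mem (hpC a ha) (hqC a ha)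
  have hTg : IsNilpotent (T * g) := by
    rw [hg, Finset.mul_sum]
    have hmem : ∀ a ∈ F, T * (p a * q a) ∈ C := fun a ha =>
      C.mul_mem hTC (C.mul_mem (hpC a ha) (hqC a ha))
    refine Commute.isNilpotent_sum (fun a ha => ?_) fun a b ha hb =>
      hcomm _ (hmem a ha) _ (hmem b hb)
    have e : T * (p a * q a) = (l - algebraMap ℂ R a) * p a * q a -
        p a * ((r - algebraMap ℂ R (a - z)) * q a) := by
      have : T = (l - algebraMap ℂ R a) - (r - algebraMap ℂ R (a - z)) := by
        rw [hT, map_sub]; abel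
      rw [this, sub_mul (l - algebraMap ℂ R a), ← mul_assoc, ← mul_assoc, ← mul_assoc,
        (hcomm _ (hraC (a - z)) _ (hpC a ha)).eq]
    have m1 := C.mul_mem (hlaC a) (hpC a ha)
    have m2 := C.mul_mem (hraC (a - z)) (hqC a ha)
    rw [e]
    refine Commute.isNilpotent_sub
      (hcomm _ (C.mul_mem m1 (hqC a ha)) _ (C.mul_mem (hpC a ha) m2)) ?_ ?_
    · exact (hcomm _ m1 _ (hqC a ha)).isNilpotent_mul_right (hpn a ha)
    · exact (hcomm _ (hpC a ha) _ m2).isNilpotent_mul_left (hqn a ha)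
  refine isDrazin_of_isNilpotent_mul (hcomm _ hTC _ hgC) hTg ?_
  by_contra hnu
  obtain ⟨φ, h0, hφ⟩ := hchar ⟨T + g, C.add_mem hTC hgC⟩ hnu
  have e0 : φ ⟨T, hTC⟩ + φ ⟨g, hgC⟩ = 0 := by rw [← map_add]; exact h0
  have e1 : φ ⟨T, hTC⟩ * φ ⟨g, hgC⟩ = 0 := by
    rw [← map_mul]
    exact spectrum_subset_of_isNilpotent hTg (hφ (⟨T, hTC⟩ * ⟨g, hgC⟩))
  have hφl : ∀ a : ℂ, φ ⟨l - algebraMap ℂ R a, hlaC a⟩ = φ ⟨l, hlC⟩ - a := fun a =>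
    (map_sub φ ⟨l, hlC⟩ (algebraMap ℂ C a)).trans (by rw [AlgHom.commutes]; rfl)
  have hφr : ∀ a : ℂ, φ ⟨r - algebraMap ℂ R a, hraC a⟩ = φ ⟨r, hrC⟩ - a := fun a =>
    (map_sub φ ⟨r, hrC⟩ (algebraMap ℂ C a)).trans (by rw [AlgHom.commutes]; rfl)
  have e2 : φ ⟨T, hTC⟩ = φ ⟨l, hlC⟩ - φ ⟨r, hrC⟩ - z :=
    (map_sub φ (⟨l, hlC⟩ - ⟨r, hrC⟩) (algebraMap ℂ C z)).trans
      (by rw [AlgHom.commutes, map_sub]; rfl)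
  by_cases hT0 : φ ⟨T, hTC⟩ = 0
  · -- the only summand of `g` that `φ` does not kill is the one indexed by `φ l`
    set α := φ ⟨l, hlC⟩ with hα
    have hβ : φ ⟨r, hrC⟩ = α - z := by rw [hT0] at e2; linear_combination e2
    have hαF : α ∈ F := hF α (hφ ⟨l, hlC⟩) (hβ ▸ hφ ⟨r, hrC⟩)
    have hp1 : φ ⟨p α, hpC α hαF⟩ = 1 :=
      character_eq_one hφ (hlaC α) _ (hpi α hαF) (hpu α hαF) (by rw [hφl, sub_self])
    have hq1 : φ ⟨q α, hqC α hαF⟩ = 1 :=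
      character_eq_one hφ (hraC (α - z)) _ (hqi α hαF) (hqu α hαF) (by rw [hφr, hβ, sub_self])
    have e3 : (⟨g, hgC⟩ : C) = ∑ a ∈ F.attach, ⟨p a, hpC a a.2⟩ * ⟨q a, hqC a a.2⟩ := by
      refine Subtype.ext ?_
      rw [AddSubmonoidClass.coe_finsetSum]
      exact (Finset.sum_attach F fun a => p a * q a).symm
    have e4 : φ ⟨g, hgC⟩ = 1 := by
      rw [e3, map_sum, Finset.sum_eq_single ⟨α, hαF⟩]
      · rw [map_mul, hp1, hq1, one_mul]
      · intro a _ ha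
        have hne : φ ⟨l - algebraMap ℂ R a, hlaC a⟩ ≠ 0 := by
          rw [hφl, sub_ne_zero]
          exact fun h => ha (Subtype.ext h.symm)
        rw [map_mul, character_eq_zero hφ (hlaC a) (hpC a a.2)
          (spectrum_subset_of_isNilpotent (hpn a a.2)) hne, zero_mul]
      · exact fun h => absurd (Finset.mem_attach _ _) h
    rw [hT0, e4, zero_add] at e0
    exact one_ne_zero e0
  · rw [(mul_eq_zero.1 e1).resolve_left hT0, add_zero] at e0
    exact hT0 e0

end BanachAlgebra

section DerivationDrazin

variable {X Y : Type*} [NormedAddCommGroup X] [NormedSpace ℂ X]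
  [NormedAddCommGroup Y] [NormedSpace ℂ Y]

/-- The set is compact, and discrete because `A - a` is Drazin invertible at each of its points. -/
theorem finite_spectrum_fiber [CompleteSpace X] [CompleteSpace Y] {A : X →L[ℂ] X} {B : Y →L[ℂ] Y}
    {z : ℂ} (h : ∀ a ∈ spectrum ℂ A, a - z ∈ spectrum ℂ B → IsDrazin (A - a • 1)) :
    {a | a ∈ spectrum ℂ A ∧ a - z ∈ spectrum ℂ B}.Finite := by
  set F := {a | a ∈ spectrum ℂ A ∧ a - z ∈ spectrum ℂ B}
  have hF : IsCompact F := (spectrum.isCompact (𝕜 := ℂ) A).inter_right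
    ((spectrum.isClosed (𝕜 := ℂ) B).preimage (continuous_sub_right z))
  by_contra hinf
  obtain ⟨a, ha, hacc⟩ := Set.Infinite.exists_accPt_of_subset_isCompact hinf hF subset_rfl
  obtain ⟨ε, hε, hu⟩ := (h a ha.1 ha.2).isUnit_sub
  obtain ⟨b, hb, hba⟩ := accPt_iff_nhds.1 hacc _ (Metric.ball_mem_nhds a hε)
  refine mem_spectrum_iff.1 hb.2.1 ?_
  have := hu (b - a) (sub_ne_zero.2 hba) (by rw [← dist_eq_norm]; exact hb.1)
  rwa [Algebra.algebraMap_eq_smul_one, sub_sub, ← add_smul, add_sub_cancel] at this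

theorem isDrazin_genDerivation [CompleteSpace X] [CompleteSpace Y] {A : X →L[ℂ] X}
    {B : Y →L[ℂ] Y} {z : ℂ}
    (hA : ∀ a ∈ spectrum ℂ A, a - z ∈ spectrum ℂ B → IsDrazin (A - a • 1))
    (hB : ∀ a ∈ spectrum ℂ A, a - z ∈ spectrum ℂ B → IsDrazin (B - (a - z) • 1)) :
    IsDrazin (genDerivation A B - z • 1) := by
  have hfin := finite_spectrum_fiber hA
  set F := hfin.toFinset with hFdef
  have hF : ∀ a, a ∈ F ↔ a ∈ spectrum ℂ A ∧ a - z ∈ spectrum ℂ B := fun a => by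
    rw [hFdef, Set.Finite.mem_toFinset]; rfl
  have hex : ∀ a, ∃ P Q, a ∈ F →
      (IsSpectralIdempotent (A - a • 1) P ∧ IsNilpotent ((A - a • 1) * P)) ∧
      (IsSpectralIdempotent (B - (a - z) • 1) Q ∧ IsNilpotent ((B - (a - z) • 1) * Q)) := by
    intro a
    by_cases ha : a ∈ F
    · obtain ⟨P, hP⟩ := (hA a ((hF a).1 ha).1 ((hF a).1 ha).2).exists_isSpectralIdempotent
      obtain ⟨Q, hQ⟩ := (hB a ((hF a).1 ha).1 ((hF a).1 ha).2).exists_isSpectralIdempotent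
      exact ⟨P, Q, fun _ => ⟨hP, hQ⟩⟩
    · exact ⟨0, 0, fun h => absurd h ha⟩
  choose P Q hPQ using hex
  have hcl : ∀ a : ℂ, leftMul Y A - algebraMap ℂ _ a = leftMul Y (A - a • 1) := fun a => by
    rw [map_sub, ← Algebra.algebraMap_eq_smul_one, AlgHom.commutes]
  have hcr : ∀ b : ℂ, rightMul X (MulOpposite.op B) - algebraMap ℂ _ b =
      rightMul X (MulOpposite.op (B - b • 1)) := fun b => by
    rw [MulOpposite.op_sub, map_sub, ← Algebra.algebraMap_eq_smul_one,
      ← MulOpposite.algebraMap_apply, AlgHom.commutes]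
  have hPA : ∀ a ∈ F, Commute (P a) A := fun a ha =>
    ((hPQ a ha).1.1.comm A
      ((Commute.refl A).sub_right ((Commute.one_right A).smul_right a))).symm
  have hQB : ∀ a ∈ F, Commute (Q a) B := fun a ha =>
    ((hPQ a ha).2.1.comm B
      ((Commute.refl B).sub_right ((Commute.one_right B).smul_right _))).symm
  have hPP : ∀ a ∈ F, ∀ b ∈ F, Commute (P a) (P b) := fun a ha b hb =>
    (hPQ b hb).1.1.comm _ ((hPA a ha).sub_right ((Commute.one_right _).smul_right _))
  have hQQ : ∀ a ∈ F, ∀ b ∈ F, Commute (Q a) (Q b) := fun a ha b hb =>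
    (hPQ b hb).2.1.comm _ ((hQB a ha).sub_right ((Commute.one_right _).smul_right _))
  have hlr : ∀ (V : X →L[ℂ] X) (W : Y →L[ℂ] Y),
      Commute (leftMul Y V) (rightMul X (MulOpposite.op W)) := fun V W =>
    commute_leftMul_rightMul _ _
  have hll : ∀ {V W : X →L[ℂ] X}, Commute V W → Commute (leftMul Y V) (leftMul Y W) := fun h =>
    h.map (leftMul Y)
  have hrr : ∀ {V W : Y →L[ℂ] Y}, Commute V W →
      Commute (rightMul X (MulOpposite.op V)) (rightMul X (MulOpposite.op W)) := fun h =>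
    h.op.map (rightMul X)
  rw [genDerivation_eq, ← Algebra.algebraMap_eq_smul_one]
  refine isDrazin_sub_sub_algebraMap (F := F) (p := fun a => leftMul Y (P a))
    (q := fun a => rightMul X (MulOpposite.op (Q a))) ?_ ?_ ?_ ?_ ?_ ?_ ?_ ?_
  · rintro x (((rfl | rfl) | ⟨a, ha, rfl⟩) | ⟨a, ha, rfl⟩) y
      (((rfl | rfl) | ⟨b, hb, rfl⟩) | ⟨b, hb, rfl⟩)
    · exact Commute.refl _
    · exact hlr _ _
    · exact hll (hPA b hb).symm
    · exact hlr _ _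
    · exact (hlr _ _).symm
    · exact Commute.refl _
    · exact (hlr _ _).symm
    · exact hrr (hQB b hb).symm
    · exact hll (hPA a ha)
    · exact hlr _ _
    · exact hll (hPP a ha b hb)
    · exact hlr _ _
    · exact (hlr _ _).symm
    · exact hrr (hQB a ha)
    · exact (hlr _ _).symm
    · exact hrr (hQQ a ha b hb)
  · exact fun a ha hb => (hF a).2 ⟨spectrum_leftMul_subset A ha, spectrum_rightMul_subset B hb⟩
  · exact fun a ha => by rw [← map_mul, (hPQ a ha).1.1.idem]
  · exact fun a ha => by rw [← map_mul, ← MulOpposite.op_mul, (hPQ a ha).2.1.idem]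
  · intro a ha
    rw [hcl, ← map_mul]
    exact (hPQ a ha).1.2.map (leftMul Y)
  · intro a ha
    rw [hcr, ← map_mul, ← MulOpposite.op_mul, ← (hPQ a ha).2.1.commute.eq]
    obtain ⟨n, hn⟩ := (hPQ a ha).2.2
    exact IsNilpotent.map ⟨n, by rw [← MulOpposite.op_pow, hn, MulOpposite.op_zero]⟩ (rightMul X)
  · intro a ha
    rw [hcl, ← map_add]
    exact (hPQ a ha).1.1.isUnit.map (leftMul Y)
  · intro a ha
    rw [hcr, ← map_add, ← MulOpposite.op_add]
    exact (isUnit_op.2 (hPQ a ha).2.1.isUnit).map (rightMul X)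

end DerivationDrazin

/-! ### Drazin invertibility of the coefficients from that of the derivation -/

section BanachAlgebra

open Polynomial

variable {R : Type*} [NormedRing R] [NormedAlgebra ℂ R]

theorem coe_aeval_mk {C : Subalgebra ℂ R} {T : R} (hT : T ∈ C) (s : ℂ[X]) :
    ((aeval (⟨T, hT⟩ : C) s : C) : R) = aeval T s :=
  (aeval_algHom_apply C.val (⟨T, hT⟩ : C) s).symm

variable [CompleteSpace R]

/-- A spectral idempotent dominates every commuting idempotent on which `T` is quasinilpotent. -/
theorem IsSpectralIdempotent.mul_eq_of_quasinilpotent {T e K : R} (h : IsSpectralIdempotent T e)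
    (hK : K * K = K) (hTK : Commute T K) (hq : spectrum ℂ (T * K) ⊆ {0}) : e * K = K := by
  have hKe : Commute K e := h.comm K hTK.symm
  -- `(1 - e) * K` is an idempotent annihilated by all characters, hence zero
  have hu : IsUnit (1 - (1 - e) * K) := by
    refine isUnit_of_character h.commute hTK hKe.symm (fun C hT he hK => C.sub_mem C.one_mem
      (C.mul_mem (C.sub_mem C.one_mem he) hK)) ?_
    intro C hTC heC hKC φ hφ h0
    have e0 : 1 - (1 - φ ⟨e, heC⟩) * φ ⟨K, hKC⟩ = 0 := by
      rw [← map_one φ, ← map_sub, ← map_mul, ← map_sub]; exact h0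
    by_cases hT0 : φ ⟨T, hTC⟩ = 0
    · rw [character_eq_one hφ hTC heC h.idem h.isUnit hT0] at e0
      norm_num at e0
    · rw [character_eq_zero hφ hTC hKC hq hT0] at e0
      norm_num at e0
  have hid : ((1 - e) * K) * ((1 - e) * K) = (1 - e) * K := by
    have h1 : (1 - e) * (1 - e) = 1 - e := IsIdempotentElem.one_sub h.idem
    rw [mul_assoc, ← mul_assoc K, ((Commute.one_right K).sub_right hKe).eq, mul_assoc, hK,
      ← mul_assoc, h1]
  have h0 : (1 - e) * K = 0 := by
    have : (1 - (1 - e) * K) * ((1 - e) * K) = 0 := by rw [sub_mul, one_mul, hid, sub_self]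
    exact (hu.mul_right_eq_zero).1 this
  rw [sub_mul, one_mul, sub_eq_zero] at h0
  exact h0.symm

/-- A Drazin invertible element is nilpotent on any idempotent on which it is quasinilpotent. -/
theorem IsDrazin.exists_pow_mul_eq_zero {T K : R} (h : IsDrazin T) (hK : K * K = K)
    (hTK : Commute T K) (hq : spectrum ℂ (T * K) ⊆ {0}) : ∃ m, T ^ m * K = 0 := by
  obtain ⟨e, he, m, hm⟩ := h.exists_isSpectralIdempotent
  refine ⟨m, ?_⟩
  calc T ^ m * K = T ^ m * e ^ (m + 1) * K := by
        rw [IsIdempotentElem.pow_succ_eq m he.idem, mul_assoc,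
          he.mul_eq_of_quasinilpotent hK hTK hq]
    _ = (T * e) ^ m * e * K := by rw [pow_succ, he.commute.mul_pow]; simp only [mul_assoc]
    _ = 0 := by rw [hm, zero_mul, zero_mul]

/-- A quasinilpotent element that is algebraic is nilpotent. -/
theorem IsSpectralIdempotent.isNilpotent_of_aeval {T P : R} (h : IsSpectralIdempotent T P)
    {q : ℂ[X]} (hq : q ≠ 0) (h0 : aeval T q * P = 0) : IsNilpotent (T * P) := by
  obtain ⟨s, hs, hdvd⟩ := exists_eq_pow_rootMultiplicity_mul_and_not_dvd q hq 0
  rw [map_zero, sub_zero] at hs hdvd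
  set k := rootMultiplicity 0 q
  have hs0 : s.eval 0 ≠ 0 := by
    rw [← coeff_zero_eq_eval_zero]; exact fun h => hdvd (X_dvd_iff.2 h)
  have hsT : Commute (aeval T s) T := by
    have := congrArg (aeval T) (mul_comm s X)
    rwa [map_mul, map_mul, aeval_X] at this
  have hsP : Commute (aeval T s) P := h.comm _ hsT
  -- `s(T)` is invertible on the range of `P`, as `s(0) ≠ 0` and `T` is quasinilpotent there
  have hu : IsUnit (aeval T s * P + (1 - P)) := by
    refine isUnit_of_character h.commute (Commute.refl T) h.commute.symm
      (fun C hT hP _ => C.add_mem (C.mul_mem (coe_aeval_mk hT s ▸ Subtype.prop _) hP)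
        (C.sub_mem C.one_mem hP)) ?_
    intro C hTC hPC _ φ hφ e0
    have e1 : s.eval (φ ⟨T, hTC⟩) * φ ⟨P, hPC⟩ + (1 - φ ⟨P, hPC⟩) = 0 := by
      have e2 : φ (aeval ⟨T, hTC⟩ s * ⟨P, hPC⟩ + (1 - ⟨P, hPC⟩)) = 0 := by
        rw [← e0]
        congr 1
        refine Subtype.ext ?_
        simp [coe_aeval_mk hTC s]
      rwa [map_add, map_mul, map_sub, map_one, ← aeval_algHom_apply, coe_aeval_eq_eval] at e2
    by_cases hT0 : φ ⟨T, hTC⟩ = 0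
    · rw [character_eq_one hφ hTC hPC h.idem h.isUnit hT0, hT0] at e1
      exact hs0 (by simpa using e1)
    · rw [character_eq_zero hφ hTC hPC h.quasinilpotent hT0] at e1
      norm_num at e1
  have hk : T ^ k * P = 0 := by
    have e3 : T ^ k * P * (aeval T s * P + (1 - P)) = 0 := by
      have e4 : P * (1 - P) = 0 := by rw [mul_sub, h.idem, mul_one, sub_self]
      rw [hs, map_mul, map_pow, aeval_X] at h0
      rw [mul_add, mul_assoc _ P (1 - P), e4, mul_zero, add_zero, hsP.eq, mul_assoc,
        ← mul_assoc P P, h.idem, ← hsP.eq, ← mul_assoc, h0]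
    exact (hu.mul_left_eq_zero).1 e3
  refine ⟨k + 1, ?_⟩
  rw [h.commute.mul_pow, IsIdempotentElem.pow_succ_eq k h.idem, pow_succ', mul_assoc, hk, mul_zero]

end BanachAlgebra

section RankOne

open Polynomial

variable {X Y : Type*} [NormedAddCommGroup X] [NormedSpace ℂ X]
  [NormedAddCommGroup Y] [NormedSpace ℂ Y]

theorem genDerivation_smulRight (A : X →L[ℂ] X) (B : Y →L[ℂ] Y) (f : Y →L[ℂ] ℂ) (x : X) :
    genDerivation A B (f.smulRight x) = f.smulRight (A x) - (f.comp B).smulRight x := by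
  rw [genDerivation_apply]
  ext y
  simp

/-- Evaluated at `y`, the operator `ρ ^ m (x ⊗ f)` is a polynomial in `A` applied to `x`. Its degree
is at most `m`, and the coefficient `f y` at `m` shows that it is nonzero if `f y ≠ 0`. -/
theorem exists_polynomial_left (A : X →L[ℂ] X) (B : Y →L[ℂ] Y) (m : ℕ) (f : Y →L[ℂ] ℂ) (y : Y) :
    ∃ q : ℂ[X], q.natDegree ≤ m ∧ q.coeff m = f y ∧
      ∀ x, (genDerivation A B ^ m) (f.smulRight x) y = aeval A q x := by
  induction m generalizing f with
  | zero =>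
    refine ⟨C (f y), by simp, by simp, fun x => ?_⟩
    simp [Algebra.algebraMap_eq_smul_one]
  | succ m ih =>
    obtain ⟨q₁, hd₁, hc₁, h₁⟩ := ih f
    obtain ⟨q₂, hd₂, hc₂, h₂⟩ := ih (f.comp B)
    refine ⟨q₁ * Polynomial.X - q₂, ?_, ?_, fun x => ?_⟩
    · refine (natDegree_sub_le _ _).trans (max_le ?_ (by omega))
      exact natDegree_mul_le.trans (add_le_add hd₁ natDegree_X_le)
    · rw [coeff_sub, coeff_mul_X, hc₁, coeff_eq_zero_of_natDegree_lt (by omega), sub_zero]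
    · rw [pow_succ, mul_apply_eq_comp, genDerivation_smulRight, map_sub, sub_apply, h₁, h₂,
        map_sub, map_mul, aeval_X]
      rfl

/-- The counterpart of `exists_polynomial_left` in terms of `B`, after applying a functional `g`. -/
theorem exists_polynomial_right (A : X →L[ℂ] X) (B : Y →L[ℂ] Y) (m : ℕ) (g : X →L[ℂ] ℂ) (x : X) :
    ∃ q : ℂ[X], q.natDegree ≤ m ∧ q.coeff m = (-1) ^ m * g x ∧
      ∀ (f : Y →L[ℂ] ℂ) (y : Y), g ((genDerivation A B ^ m) (f.smulRight x) y) = f (aeval B q y) := by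
  induction m generalizing x with
  | zero =>
    refine ⟨C (g x), by simp, by simp, fun f y => ?_⟩
    simp [Algebra.algebraMap_eq_smul_one, mul_comm]
  | succ m ih =>
    obtain ⟨q₁, hd₁, hc₁, h₁⟩ := ih (A x)
    obtain ⟨q₂, hd₂, hc₂, h₂⟩ := ih x
    refine ⟨q₁ - Polynomial.X * q₂, ?_, ?_, fun f y => ?_⟩
    · refine (natDegree_sub_le _ _).trans (max_le (by omega) ?_)
      exact natDegree_mul_le.trans ((add_le_add natDegree_X_le hd₂).trans (by omega))
    · rw [coeff_sub, coeff_X_mul, hc₂, coeff_eq_zero_of_natDegree_lt (by omega)]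
      ring
    · rw [pow_succ, mul_apply_eq_comp, genDerivation_smulRight, map_sub, sub_apply, map_sub, h₁, h₂,
        map_sub, map_mul, aeval_X, sub_apply, map_sub]
      rfl

end RankOne

section Converse

open Polynomial

variable {X Y : Type*} [NormedAddCommGroup X] [NormedSpace ℂ X]
  [NormedAddCommGroup Y] [NormedSpace ℂ Y]

theorem IsSpectralIdempotent.exists_apply_ne_zero {A P : X →L[ℂ] X}
    (hP : IsSpectralIdempotent A P) (hA : ¬ IsUnit A) : ∃ x, P x = x ∧ x ≠ 0 := by
  by_contra hcon
  push Not at hcon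
  refine hA ?_
  have : P = 0 := by
    ext x
    exact hcon _ (DFunLike.congr_fun hP.idem x)
  simpa [this] using hP.isUnit

variable [CompleteSpace X]

/-- `U ↦ ρ(P U Q)` is quasinilpotent. -/
theorem spectrum_genDerivation_mul_subset {A : X →L[ℂ] X} {B : Y →L[ℂ] Y} {P : X →L[ℂ] X}
    {Q : Y →L[ℂ] Y} (hP : IsSpectralIdempotent A P) (hQ : IsSpectralIdempotent B Q) :
    spectrum ℂ (genDerivation A B * (leftMul Y P * rightMul X (MulOpposite.op Q))) ⊆ {0} := by
  intro z hz
  set l := leftMul Y A with hl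
  set r := rightMul X (MulOpposite.op B) with hr
  set p := leftMul Y P with hp
  set q := rightMul X (MulOpposite.op Q) with hq
  have hlp : Commute l p := hP.commute.map (leftMul Y)
  have hrq : Commute r q := hQ.commute.op.map (rightMul X)
  have hlr : Commute l r := commute_leftMul_rightMul _ _
  have hlq : Commute l q := commute_leftMul_rightMul _ _
  have hpr : Commute p r := commute_leftMul_rightMul _ _
  have hpq : Commute p q := commute_leftMul_rightMul _ _
  obtain ⟨C, hC, -, hchar⟩ := exists_subalgebra_character {l, r, p, q} (by
    rintro x (rfl | rfl | rfl | rfl) y (rfl | rfl | rfl | rfl) <;>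
    first | exact Commute.refl _ | assumption | (apply Commute.symm; assumption))
  have hlC : l ∈ C := hC (by simp)
  have hrC : r ∈ C := hC (by simp)
  have hpC : p ∈ C := hC (by simp)
  have hqC : q ∈ C := hC (by simp)
  have hw : algebraMap ℂ _ z - (l - r) * (p * q) ∈ C := C.sub_mem (C.algebraMap_mem z)
    (C.mul_mem (C.sub_mem hlC hrC) (C.mul_mem hpC hqC))
  obtain ⟨φ, h0, hφ⟩ := hchar ⟨_, hw⟩ (spectrum.mem_iff.1 hz)
  have e0 : z - (φ ⟨l, hlC⟩ - φ ⟨r, hrC⟩) * (φ ⟨p, hpC⟩ * φ ⟨q, hqC⟩) = 0 := by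
    have : φ (algebraMap ℂ C z - (⟨l, hlC⟩ - ⟨r, hrC⟩) * (⟨p, hpC⟩ * ⟨q, hqC⟩)) = 0 := h0
    rwa [map_sub, AlgHom.commutes, map_mul, map_mul, map_sub] at this
  have e1 : φ ⟨l, hlC⟩ * φ ⟨p, hpC⟩ = 0 := by
    rw [← map_mul]
    have h1 := hφ (⟨l, hlC⟩ * ⟨p, hpC⟩)
    have h2 : ((⟨l, hlC⟩ * ⟨p, hpC⟩ : C) : (Y →L[ℂ] X) →L[ℂ] (Y →L[ℂ] X)) =
      leftMul Y (A * P) := (map_mul _ _ _).symm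
    rw [h2] at h1
    exact hP.quasinilpotent (spectrum_leftMul_subset _ h1)
  have e2 : φ ⟨r, hrC⟩ * φ ⟨q, hqC⟩ = 0 := by
    rw [← map_mul]
    have h1 := hφ (⟨r, hrC⟩ * ⟨q, hqC⟩)
    have h2 : ((⟨r, hrC⟩ * ⟨q, hqC⟩ : C) : (Y →L[ℂ] X) →L[ℂ] (Y →L[ℂ] X)) =
      rightMul X (MulOpposite.op (B * Q)) := by
        rw [hQ.commute.eq, MulOpposite.op_mul, map_mul]; rfl
    rw [h2] at h1
    exact hQ.quasinilpotent (spectrum_rightMul_subset _ h1)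
  rw [Set.mem_singleton_iff]
  linear_combination e0 + φ ⟨q, hqC⟩ * e1 - φ ⟨p, hpC⟩ * e2

theorem IsDrazin.exists_pow_apply_eq_zero {T K : X →L[ℂ] X} (h : IsDrazin T) (hK : K * K = K)
    (hTK : Commute T K) (hq : spectrum ℂ (T * K) ⊆ {0}) : ∃ m, ∀ x, (T ^ m) (K x) = 0 := by
  obtain ⟨m, hm⟩ := h.exists_pow_mul_eq_zero hK hTK hq
  exact ⟨m, fun x => DFunLike.congr_fun hm x⟩

theorem exists_pow_genDerivation_eq_zero {A : X →L[ℂ] X} {B : Y →L[ℂ] Y} {P : X →L[ℂ] X}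
    {Q : Y →L[ℂ] Y} (hP : IsSpectralIdempotent A P) (hQ : IsSpectralIdempotent B Q)
    (h : IsDrazin (genDerivation A B)) :
    ∃ m, ∀ (f : Y →L[ℂ] ℂ) (x : X),
      (genDerivation A B ^ m) ((f.comp Q).smulRight (P x)) = 0 := by
  set T := genDerivation A B with hT
  set K := leftMul Y P * rightMul X (MulOpposite.op Q) with hK
  have hpq : Commute (leftMul Y P) (rightMul X (MulOpposite.op Q)) :=
    commute_leftMul_rightMul _ _
  have hKK : K * K = K := by
    refine IsIdempotentElem.mul_of_commute hpq ?_ ?_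
    · rw [IsIdempotentElem, ← map_mul, hP.idem]
    · rw [IsIdempotentElem, ← map_mul, ← MulOpposite.op_mul, hQ.idem]
  have hTK : Commute T K := by
    have h1 : Commute (leftMul Y A) (leftMul Y P) := hP.commute.map (leftMul Y)
    have h2 : Commute (rightMul X (MulOpposite.op B)) (rightMul X (MulOpposite.op Q)) :=
      hQ.commute.op.map (rightMul X)
    have h3 : Commute (leftMul Y A) (rightMul X (MulOpposite.op Q)) :=
      commute_leftMul_rightMul _ _
    have h4 : Commute (rightMul X (MulOpposite.op B)) (leftMul Y P) :=
      (commute_leftMul_rightMul _ _).symm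
    rw [hT, genDerivation_eq]
    exact (h1.mul_right h3).sub_left (h4.mul_right h2)
  obtain ⟨m, hm⟩ := IsDrazin.exists_pow_apply_eq_zero h hKK hTK
    (spectrum_genDerivation_mul_subset hP hQ)
  refine ⟨m, fun f x => ?_⟩
  have e1 : (f.comp Q).smulRight (P x) = K (f.smulRight x) := by
    ext y
    simp [hK, mul_apply_eq_comp, leftMul_apply, rightMul_apply]
  rw [e1]
  exact hm _

theorem isDrazin_left_of_genDerivation {A : X →L[ℂ] X} {B : Y →L[ℂ] Y} {P : X →L[ℂ] X}
    {Q : Y →L[ℂ] Y} (hP : IsSpectralIdempotent A P) (hQ : IsSpectralIdempotent B Q)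
    (hB : ¬ IsUnit B) (h : IsDrazin (genDerivation A B)) : IsDrazin A := by
  obtain ⟨m, hm⟩ := exists_pow_genDerivation_eq_zero hP hQ h
  obtain ⟨y, hy, hy0⟩ := hQ.exists_apply_ne_zero hB
  obtain ⟨f, hf⟩ := SeparatingDual.exists_ne_zero (R := ℂ) hy0
  obtain ⟨q, -, hc, hq⟩ := exists_polynomial_left A B m (f.comp Q) y
  refine hP.isDrazin (hP.isNilpotent_of_aeval (q := q) ?_ ?_)
  · rintro rfl
    rw [coeff_zero, ContinuousLinearMap.comp_apply, hy] at hc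
    exact hf hc.symm
  · ext x
    rw [mul_apply_eq_comp, ← hq, hm]
    rfl

variable [CompleteSpace Y]

theorem isDrazin_right_of_genDerivation {A : X →L[ℂ] X} {B : Y →L[ℂ] Y} {P : X →L[ℂ] X}
    {Q : Y →L[ℂ] Y} (hP : IsSpectralIdempotent A P) (hQ : IsSpectralIdempotent B Q)
    (hA : ¬ IsUnit A) (h : IsDrazin (genDerivation A B)) : IsDrazin B := by
  obtain ⟨m, hm⟩ := exists_pow_genDerivation_eq_zero hP hQ h
  obtain ⟨x, hx, hx0⟩ := hP.exists_apply_ne_zero hA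
  obtain ⟨g, hg⟩ := SeparatingDual.exists_ne_zero (R := ℂ) hx0
  obtain ⟨q, -, hc, hq⟩ := exists_polynomial_right A B m g x
  refine hQ.isDrazin (hQ.isNilpotent_of_aeval (q := q) ?_ ?_)
  · rintro rfl
    rw [coeff_zero] at hc
    exact mul_ne_zero (pow_ne_zero m (by norm_num)) hg hc.symm
  · have hcom : Commute (aeval B q) Q := hQ.comm _ (by
      have := congrArg (aeval B) (mul_comm q Polynomial.X)
      rwa [map_mul, map_mul, aeval_X] at this)
    rw [hcom.eq]
    ext y
    rw [SeparatingDual.eq_iff_forall_dual_eq (R := ℂ)]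
    intro f
    have := hq (f.comp Q) y
    rw [← hx, hm] at this
    simpa using this.symm

end Converse

/-! ### Isolated points of the spectrum -/

section IsolatedPoints

variable {X Y : Type*} [NormedAddCommGroup X] [NormedSpace ℂ X]
  [NormedAddCommGroup Y] [NormedSpace ℂ Y]

theorem mem_acc_iff {K : Set ℂ} {z : ℂ} :
    z ∈ acc K ↔ ∀ ε > 0, ∃ w ∈ K, w ≠ z ∧ dist w z < ε := by
  change AccPt z (Filter.principal K) ↔ _
  rw [accPt_iff_nhds]
  constructor
  · intro h ε hε
    obtain ⟨w, hw, hne⟩ := h _ (Metric.ball_mem_nhds z hε)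
    exact ⟨w, hw.2, hne, hw.1⟩
  · intro h U hU
    obtain ⟨ε, hε, hb⟩ := Metric.mem_nhds_iff.1 hU
    obtain ⟨w, hw, hne, hd⟩ := h ε hε
    exact ⟨w, ⟨hb hd, hw⟩, hne⟩

theorem sub_smul_sub_algebraMap (T : X →L[ℂ] X) (z w : ℂ) :
    T - z • 1 - algebraMap ℂ (X →L[ℂ] X) w = T - (z + w) • 1 := by
  rw [Algebra.algebraMap_eq_smul_one, sub_sub, ← add_smul]

theorem notMem_drazinSpectrum {T : X →L[ℂ] X} {z : ℂ} :
    z ∉ drazinSpectrum T ↔ IsDrazin (T - z • 1) := not_not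

variable [CompleteSpace X]

theorem poles_subset_iso (T : X →L[ℂ] X) : poles T ⊆ iso (spectrum ℂ T) := by
  intro z hz
  obtain ⟨hzs, hD⟩ := mem_poles_iff.1 hz
  refine ⟨hzs, fun hacc => ?_⟩
  obtain ⟨ε, hε, hu⟩ := hD.isUnit_sub
  obtain ⟨w, hw, hne, hd⟩ := mem_acc_iff.1 hacc ε hε
  have := hu (w - z) (sub_ne_zero.2 hne) (by rwa [← dist_eq_norm])
  rw [sub_smul_sub_algebraMap, add_sub_cancel] at this
  exact mem_spectrum_iff.1 hw this

theorem exists_isSpectralIdempotent_of_mem_iso {T : X →L[ℂ] X} {z : ℂ}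
    (hz : z ∈ iso (spectrum ℂ T)) : ∃ P, IsSpectralIdempotent (T - z • 1) P := by
  have h := hz.2
  rw [mem_acc_iff] at h
  push Not at h
  obtain ⟨ε, hε, h⟩ := h
  refine exists_isSpectralIdempotent hε fun w hw0 hw => ?_
  rw [spectrum.mem_resolventSet_iff, ← IsUnit.neg_iff, neg_sub, sub_smul_sub_algebraMap]
  by_contra hcon
  have := h (z + w) (mem_spectrum_iff.2 hcon) (by simpa using hw0)
  rw [dist_eq_norm, add_sub_cancel_left] at this
  linarith

variable [CompleteSpace Y]

theorem mem_iso_of_sub_notMem_acc {A : X →L[ℂ] X} {B : Y →L[ℂ] Y} {a b : ℂ}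
    (ha : a ∈ spectrum ℂ A) (hb : b ∈ spectrum ℂ B)
    (h : a - b ∉ acc (spectrum ℂ (genDerivation A B))) :
    a ∈ iso (spectrum ℂ A) ∧ b ∈ iso (spectrum ℂ B) := by
  rw [spectrum_genDerivation, mem_acc_iff] at h
  refine ⟨⟨ha, fun hacc => h fun ε hε => ?_⟩, ⟨hb, fun hacc => h fun ε hε => ?_⟩⟩
  · obtain ⟨w, hw, hne, hd⟩ := mem_acc_iff.1 hacc ε hε
    exact ⟨w - b, ⟨w, hw, b, hb, rfl⟩, by simpa using hne, by simpa using hd⟩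
  · obtain ⟨w, hw, hne, hd⟩ := mem_acc_iff.1 hacc ε hε
    exact ⟨a - w, ⟨a, ha, w, hw, rfl⟩, by simpa using hne, by rwa [dist_sub_left]⟩

/-- An isolated point of `σ(ρ)` is a pole exactly when each of its representations as a difference
of spectral values of `A` and `B` is a difference of poles. -/
theorem mem_poles_genDerivation_iff {A : X →L[ℂ] X} {B : Y →L[ℂ] Y} {z : ℂ}
    (hz : z ∈ iso (spectrum ℂ (genDerivation A B))) :
    z ∈ poles (genDerivation A B) ↔
      ∀ a ∈ spectrum ℂ A, ∀ b ∈ spectrum ℂ B, a - b = z → a ∈ poles A ∧ b ∈ poles B := by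
  constructor
  · rintro h a ha b hb rfl
    obtain ⟨hia, hib⟩ := mem_iso_of_sub_notMem_acc ha hb hz.2
    obtain ⟨P, hP⟩ := exists_isSpectralIdempotent_of_mem_iso hia
    obtain ⟨Q, hQ⟩ := exists_isSpectralIdempotent_of_mem_iso hib
    have hD := (mem_poles_iff.1 h).2
    rw [genDerivation_sub A B rfl] at hD
    exact ⟨mem_poles_iff.2 ⟨ha, isDrazin_left_of_genDerivation hP hQ (mem_spectrum_iff.1 hb) hD⟩,
      mem_poles_iff.2 ⟨hb, isDrazin_right_of_genDerivation hP hQ (mem_spectrum_iff.1 ha) hD⟩⟩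
  · intro h
    refine mem_poles_iff.2 ⟨hz.1, isDrazin_genDerivation (fun a ha hb => ?_) fun a ha hb => ?_⟩
    · exact (mem_poles_iff.1 (h a ha _ hb (sub_sub_cancel a z)).1).2
    · exact (mem_poles_iff.1 (h a ha _ hb (sub_sub_cancel a z)).2).2

end IsolatedPoints

end GenDerivation

open GenDerivation in
theorem theorem3p5 {X : Type*} {Y : Type*}
    [NormedAddCommGroup X] [NormedSpace ℂ X] [CompleteSpace X]
    [NormedAddCommGroup Y] [NormedSpace ℂ Y] [CompleteSpace Y]
    (A : X →L[ℂ] X) (B : Y →L[ℂ] Y) :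
    GenDerivation.isoNonPoles (GenDerivation.genDerivation A B) =
        ((GenDerivation.isoNonPoles A - GenDerivation.iso (spectrum ℂ B)) ∪
          (GenDerivation.iso (spectrum ℂ A) - GenDerivation.isoNonPoles B)) \
          GenDerivation.acc (spectrum ℂ (GenDerivation.genDerivation A B)) ∧
      GenDerivation.poles (GenDerivation.genDerivation A B) =
        (GenDerivation.poles A - GenDerivation.poles B) \
          GenDerivation.drazinSpectrum (GenDerivation.genDerivation A B) := by
  have hmem : ∀ {a b : ℂ}, a ∈ spectrum ℂ A → b ∈ spectrum ℂ B →
      a - b ∈ spectrum ℂ (genDerivation A B) := fun {a b} ha hb => by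
    rw [spectrum_genDerivation]; exact ⟨a, ha, b, hb, rfl⟩
  refine ⟨Set.Subset.antisymm ?_ ?_, Set.Subset.antisymm ?_ ?_⟩
  · rintro z ⟨hz, hnp⟩
    rw [mem_poles_genDerivation_iff hz] at hnp
    push Not at hnp
    obtain ⟨a, ha, b, hb, rfl, hab⟩ := hnp
    obtain ⟨hia, hib⟩ := mem_iso_of_sub_notMem_acc ha hb hz.2
    refine ⟨?_, hz.2⟩
    by_cases hpa : a ∈ poles A
    · exact Or.inr ⟨a, hia, b, ⟨hib, hab hpa⟩, rfl⟩
    · exact Or.inl ⟨a, ⟨hia, hpa⟩, b, hib, rfl⟩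
  · rintro _ ⟨⟨a, ha, b, hb, rfl⟩ | ⟨a, ha, b, hb, rfl⟩, hacc⟩
    · have hz : a - b ∈ iso (spectrum ℂ (genDerivation A B)) := ⟨hmem ha.1.1 hb.1, hacc⟩
      exact ⟨hz, fun h =>
        ha.2 ((mem_poles_genDerivation_iff hz).1 h a ha.1.1 b hb.1 rfl).1⟩
    · have hz : a - b ∈ iso (spectrum ℂ (genDerivation A B)) := ⟨hmem ha.1 hb.1.1, hacc⟩
      exact ⟨hz, fun h =>
        hb.2 ((mem_poles_genDerivation_iff hz).1 h a ha.1 b hb.1.1 rfl).2⟩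
  · intro z hz
    have hiso : z ∈ iso (spectrum ℂ (genDerivation A B)) := poles_subset_iso _ hz
    have hzs := hiso.1
    rw [spectrum_genDerivation] at hzs
    obtain ⟨a, ha, b, hb, hab⟩ := hzs
    obtain ⟨hpa, hpb⟩ := (mem_poles_genDerivation_iff hiso).1 hz a ha b hb hab
    refine ⟨⟨a, hpa, b, hpb, hab⟩, ?_⟩
    rw [notMem_drazinSpectrum]
    exact (mem_poles_iff.1 hz).2
  · rintro _ ⟨⟨a, ha, b, hb, rfl⟩, hD⟩
    rw [notMem_drazinSpectrum] at hD
    exact mem_poles_iff.2 ⟨hmem ha.1 hb.1, hD⟩
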